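/- Let $f,g$ be two non-proportional, non-degenerate real ternary quadratic forms, with symmetric matrices $A,B$. Write $\operatorname{Disc}(q)$ for the determinant of the symmetric matrix of a ternary quadratic form $q$. The pencil generated by $f,g$ is the plane $\langle f,g\rangle$ in the space of real ternary quadratic forms. The group $PGL(3,\mathbb R)$ acts on pencils by linear changes of coordinates. Consider the nine orbits of the pencils with the following generators: I: $x^2-y^2,\ x^2-z^2$; Ia: $x^2+y^2+z^2,\ xz$; Ib: $x^2+y^2-z^2,\ xz$; II: $yz,\ x(y-z)$; IIa: $y^2+z^2,\ xz$; III: $xz,\ y^2$; IIIa: $x^2+y^2,\ z^2$; IV: $xz-y^2,\ xy$; V: $xz-y^2,\ x^2$. Let $\Phi(t,u)=\operatorname{Disc}(tf+ug)=\det(tA+uB)$ and $\phi(t)=\Phi(t,1)$. Define the tact invariant $$\operatorname{Disc}(\Phi)=\frac{\operatorname{Res}(\phi,\phi')}{27\operatorname{Disc}(f)},$$ where $\operatorname{Res}(U,V)$, the Sylvester resultant, is normalized as $c^{\deg V}\prod_\rho V(\rho)$, with $c$ the leading coefficient of $U$ and $\rho$ running over the complex roots of $U$ with multiplicity. Let $$H(t,u)=\frac{\partial^2\Phi}{\partial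 t^2}\frac{\partial^2\Phi}{\partial u^2}-\Bigl(\frac{\partial^2\Phi}{\partial t\,\partial u}\Bigr)^2$$ be the Hessian of $\Phi$. Let $\tilde A,\tilde B$ be the cofactor matrices of $A,B$, and let $\Omega$ be the matrix with $\widetilde{tA+B}=t^2\tilde A+t\,\Omega+\tilde B$. Let $M$ be the $3\times 6$ matrix whose rows list, for $S=\tilde A,\Omega,\tilde B$ in this order, the entries $S_{11},S_{22},S_{33},S_{23},S_{13},S_{12}$. Label its columns $1,2,3,\bar1,\bar2,\bar3$, and let $[ijk]$ denote its maximal minor on the columns $i,j,k$ in this order. The autopolar triangle covariant is the ternary cubic form $$\begin{aligned}G={}&-[\bar1 2 3]x^3-[1\bar2 3]y^3-[1 2\bar3]z^3+([1\bar1 3]+2[\bar3\bar2 3])xy^2+([1 2\bar1]+2[\bar2 2\bar3])xz^2\\&+([\bar2 2 3]+2[\bar1\bar3 3])yx^2+([1 2\bar2]+2[1\bar1\bar3])yz^2+([\bar3 2 3]+2[\bar1 2\bar2])zx^2\\&+([1\bar3 3]+2[1\bar2\bar1])zy^2+(-[1 2 3]+4[\bar1\bar2\bar3])xyz.\end{aligned}$$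 Then: 1. $\operatorname{Disc}(\Phi)<0$ if and only if $f,g$ generate a pencil in orbit I or Ia. 2. $\operatorname{Disc}(\Phi)>0$ if and only if $f,g$ generate a pencil in orbit Ib. 3. $\operatorname{Disc}(\Phi)=0$ if and only if $f,g$ generate a pencil in one of the six other orbits II, IIa, III, IIIa, IV, V. In this case: - $H\neq0$ and $G\neq0$ if and only if the pencil is in orbit II or IIa; - $H\neq0$ and $G=0$ if and only if the pencil is in orbit III or IIIa; - $H=0$ and $G\neq0$ if and only if the pencil is in orbit IV; - $H=0$ and $G=0$ if and only if the pencil is in orbit V. -/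

import Mathlib

namespace ConicPencil

/-- Real ternary quadratic forms, that is, quadratic forms on `ℝ³`. -/
abbrev TernaryForm := QuadraticForm ℝ (Fin 3 → ℝ)

/-- The pencil generated by `f` and `g`: their linear span in the space of ternary quadratic forms
(a plane when `f` and `g` are not proportional). -/
def pencil (f g : TernaryForm) : Submodule ℝ TernaryForm := Submodule.span ℝ {f, g}

/-- Two pencils are projectively equivalent if an invertible linear change of coordinates
`q ↦ q ∘ θ` of `ℝ³` carries the first one onto the second one. Scalar matrices act trivially on
pencils, so this is equivalence modulo `PGL(3, ℝ)`. -/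
def ProjEquiv (P Q : Submodule ℝ TernaryForm) : Prop :=
  ∃ θ : (Fin 3 → ℝ) ≃ₗ[ℝ] (Fin 3 → ℝ),
    ∀ q : TernaryForm, q ∈ P ↔ q.comp (θ : (Fin 3 → ℝ) →ₗ[ℝ] (Fin 3 → ℝ)) ∈ Q

/-- Levy's names for the nine orbits of non-degenerate pencils of conics. -/
inductive Orbit
  | I | Ia | Ib | II | IIa | III | IIIa | IV | V

/-- The monomial `xᵢ xⱼ` as a ternary quadratic form; `x, y, z` have the indices `0, 1, 2`. -/
def mono (i j : Fin 3) : TernaryForm := QuadraticMap.proj i j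

/-- Levy's representatives: two generators of one pencil in each orbit. -/
def Orbit.rep : Orbit → TernaryForm × TernaryForm
  -- `x² - y²`, `x² - z²`
  | .I => (mono 0 0 - mono 1 1, mono 0 0 - mono 2 2)
  -- `x² + y² + z²`, `xz`
  | .Ia => (mono 0 0 + mono 1 1 + mono 2 2, mono 0 2)
  -- `x² + y² - z²`, `xz`
  | .Ib => (mono 0 0 + mono 1 1 - mono 2 2, mono 0 2)
  -- `yz`, `x(y - z)`
  | .II => (mono 1 2, mono 0 1 - mono 0 2)
  -- `y² + z²`, `xz`
  | .IIa => (mono 1 1 + mono 2 2, mono 0 2)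
  -- `xz`, `y²`
  | .III => (mono 0 2, mono 1 1)
  -- `x² + y²`, `z²`
  | .IIIa => (mono 0 0 + mono 1 1, mono 2 2)
  -- `xz - y²`, `xy`
  | .IV => (mono 0 2 - mono 1 1, mono 0 1)
  -- `xz - y²`, `x²`
  | .V => (mono 0 2 - mono 1 1, mono 0 0)

/-- The forms `f, g` generate a pencil in the orbit `o`. -/
def GeneratesIn (f g : TernaryForm) (o : Orbit) : Prop :=
  ProjEquiv (pencil o.rep.1 o.rep.2) (pencil f g)

/-- `f` is non-degenerate: its symmetric bilinear form has trivial kernel. -/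
def IsNondegenerate (f : TernaryForm) : Prop :=
  (QuadraticMap.associated (R := ℝ) f).SeparatingLeft

/-- `Disc(f)`, the determinant of the (symmetric) matrix of `f`. -/
noncomputable def disc (f : TernaryForm) : ℝ := (QuadraticForm.toMatrix' f).det

/-- The characteristic form `Φ(t, u) = Disc(t f + u g)`, a binary cubic form in the variables
`t = X 0`, `u = X 1`. -/
noncomputable def charForm (f g : TernaryForm) : MvPolynomial (Fin 2) ℝ :=
  ((MvPolynomial.X 0 : MvPolynomial (Fin 2) ℝ) •
      (QuadraticForm.toMatrix' f).map (MvPolynomial.C : ℝ →+* MvPolynomial (Fin 2) ℝ) +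
    (MvPolynomial.X 1 : MvPolynomial (Fin 2) ℝ) •
      (QuadraticForm.toMatrix' g).map (MvPolynomial.C : ℝ →+* MvPolynomial (Fin 2) ℝ)).det

/-- The de-homogenized characteristic form `φ(t) = Φ(t, 1)`. -/
noncomputable def charPoly (f g : TernaryForm) : Polynomial ℝ :=
  MvPolynomial.aeval ![(Polynomial.X : Polynomial ℝ), 1] (charForm f g)

/-- The tact invariant `Disc(Φ) = Res(φ, φ') / (27 Φ₃₀)`. Here `Φ₃₀ = Disc(f)` is the coefficient
of `t³` in `φ`, which is non-zero when `f` is non-degenerate. -/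
noncomputable def tactInvariant (f g : TernaryForm) : ℝ :=
  Polynomial.resultant (charPoly f g) (Polynomial.derivative (charPoly f g)) / (27 * disc f)

/-- The Hessian determinant `H(t, u)` of the characteristic form. -/
noncomputable def hessian (f g : TernaryForm) : MvPolynomial (Fin 2) ℝ :=
  !![MvPolynomial.pderiv 0 (MvPolynomial.pderiv 0 (charForm f g)),
      MvPolynomial.pderiv 0 (MvPolynomial.pderiv 1 (charForm f g));
    MvPolynomial.pderiv 0 (MvPolynomial.pderiv 1 (charForm f g)),
      MvPolynomial.pderiv 1 (MvPolynomial.pderiv 1 (charForm f g))].det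

section Autopolar

variable {K : Type*} [CommRing K]

/-- The matrix of the tangential quadratic form of the form with symmetric matrix `A`: the matrix
of the cofactors of `A` (which is symmetric, hence equal to the adjugate). -/
def tangential (A : Matrix (Fin 3) (Fin 3) K) : Matrix (Fin 3) (Fin 3) K := A.adjugate

/-- The matrix `Ω(A, B)` in the expansion
`tangential (t A + B) = t² tangential A + t Ω(A, B) + tangential B`. -/
def omega (A B : Matrix (Fin 3) (Fin 3) K) : Matrix (Fin 3) (Fin 3) K :=
  tangential (A + B) - tangential A - tangential B

theorem tangential_expand (A B : Matrix (Fin 3) (Fin 3) K) (t : K) :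
    tangential (t • A + B) = t ^ 2 • tangential A + t • omega A B + tangential B := by
  ext i j
  fin_cases i <;> fin_cases j <;>
    simp [omega, tangential, Matrix.adjugate_fin_three] <;> ring

/-- The six entries of a symmetric matrix, in the order
`X², Y², Z², YZ, XZ, XY`. -/
def symEntries (S : Matrix (Fin 3) (Fin 3) K) : Fin 6 → K :=
  ![S 0 0, S 1 1, S 2 2, S 1 2, S 0 2, S 0 1]

/-- The `3 × 6` matrix whose rows are the entries of `tangential A`, `Ω(A, B)` and
`tangential B`. -/
def autopolarMatrix (A B : Matrix (Fin 3) (Fin 3) K) : Matrix (Fin 3) (Fin 6) K :=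
  Matrix.of ![symEntries (tangential A), symEntries (omega A B), symEntries (tangential B)]

/-- The maximal minor `[i j k]` of a `3 × 6` matrix, as a constant polynomial. -/
noncomputable def minor (M : Matrix (Fin 3) (Fin 6) K) (i j k : Fin 6) : MvPolynomial (Fin 3) K :=
  MvPolynomial.C (M.submatrix id ![i, j, k]).det

/-- The ternary cubic form in `x, y, z` whose coefficients are the following combinations of the
maximal minors of a `3 × 6` matrix with columns `1, 2, 3, 1', 2', 3'` (here numbered from `0` to
`5`). -/
noncomputable def minorCubic (M : Matrix (Fin 3) (Fin 6) K) (x y z : MvPolynomial (Fin 3) K) :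
    MvPolynomial (Fin 3) K :=
  - minor M 3 1 2 * x ^ 3 - minor M 0 4 2 * y ^ 3 - minor M 0 1 5 * z ^ 3
    + (minor M 0 3 2 + 2 * minor M 5 4 2) * (x * y ^ 2)
    + (minor M 0 1 3 + 2 * minor M 4 1 5) * (x * z ^ 2)
    + (minor M 4 1 2 + 2 * minor M 3 5 2) * (y * x ^ 2)
    + (minor M 0 1 4 + 2 * minor M 0 3 5) * (y * z ^ 2)
    + (minor M 5 1 2 + 2 * minor M 3 1 4) * (z * x ^ 2)
    + (minor M 0 5 2 + 2 * minor M 0 4 3) * (z * y ^ 2)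
    + (- minor M 0 1 2 + 4 * minor M 3 4 5) * (x * y * z)

/-- The autopolar triangle covariant of the forms with symmetric matrices `A` and `B`, a cubic form
in `x = X 0`, `y = X 1`, `z = X 2`. -/
noncomputable def autopolarTriangle (A B : Matrix (Fin 3) (Fin 3) K) : MvPolynomial (Fin 3) K :=
  minorCubic (autopolarMatrix A B) (MvPolynomial.X 0) (MvPolynomial.X 1) (MvPolynomial.X 2)

/-- The property that characterizes the autopolar triangle covariant: if the tangential forms of
the degenerate members `tᵢ A + B` of a pencil are the squares of linear forms `pᵢ`, so that the
`pᵢ` are the vertices of the autopolar triangle, then the product of the equations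
`det(pᵢ, pⱼ, p) = 0` of its sides is the Vandermonde determinant of the `tᵢ` times the
covariant. -/
theorem autopolarTriangle_spec (A B : Matrix (Fin 3) (Fin 3) K)
    (t₁ t₂ t₃ : K) (p₁ p₂ p₃ p : Fin 3 → K)
    (h₁ : tangential (t₁ • A + B) = Matrix.vecMulVec p₁ p₁)
    (h₂ : tangential (t₂ • A + B) = Matrix.vecMulVec p₂ p₂)
    (h₃ : tangential (t₃ • A + B) = Matrix.vecMulVec p₃ p₃) :
    (Matrix.of ![p₁, p₂, p]).det * (Matrix.of ![p₁, p₃, p]).det * (Matrix.of ![p₂, p₃, p]).det =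
      (t₁ - t₂) * (t₁ - t₃) * (t₂ - t₃) * MvPolynomial.eval p (autopolarTriangle A B) := by
  have e : ∀ (t : K) (q : Fin 3 → K), tangential (t • A + B) = Matrix.vecMulVec q q →
      t ^ 2 • symEntries (tangential A) + t • symEntries (omega A B) + symEntries (tangential B) =
        symEntries (Matrix.vecMulVec q q) := by
    intro t q h
    rw [← h, tangential_expand]
    ext i
    fin_cases i <;> simp [symEntries]
  have e₁ := e t₁ p₁ h₁
  have e₂ := e t₂ p₂ h₂
  have e₃ := e t₃ p₃ h₃
  have hV : ∀ u v w : Fin 6 → K, ∀ i j k : Fin 6,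
      (t₁ - t₂) * (t₁ - t₃) * (t₂ - t₃) * ((Matrix.of ![u, v, w]).submatrix id ![i, j, k]).det =
      ((Matrix.of ![t₁ ^ 2 • u + t₁ • v + w, t₂ ^ 2 • u + t₂ • v + w,
        t₃ ^ 2 • u + t₃ • v + w]).submatrix id ![i, j, k]).det := by
    intro u v w i j k
    simp [Matrix.det_fin_three]
    ring
  have hW : (t₁ - t₂) * (t₁ - t₃) * (t₂ - t₃) * MvPolynomial.eval p (autopolarTriangle A B) =
      MvPolynomial.eval p (minorCubic (Matrix.of ![symEntries (Matrix.vecMulVec p₁ p₁),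
        symEntries (Matrix.vecMulVec p₂ p₂), symEntries (Matrix.vecMulVec p₃ p₃)])
        (MvPolynomial.X 0) (MvPolynomial.X 1) (MvPolynomial.X 2)) := by
    rw [← e₁, ← e₂, ← e₃]
    simp only [autopolarTriangle, autopolarMatrix, minorCubic, minor, map_add, map_sub, map_mul,
      map_neg, map_pow, MvPolynomial.eval_X, MvPolynomial.eval_C, map_ofNat, ← hV]
    ring
  rw [hW]
  simp [minorCubic, minor, symEntries, Matrix.vecMulVec_apply, Matrix.det_fin_three]
  ring

end Autopolar

/-- The autopolar triangle covariant `G` of two ternary quadratic forms. -/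
noncomputable def covariantG (f g : TernaryForm) : MvPolynomial (Fin 3) ℝ :=
  autopolarTriangle (QuadraticForm.toMatrix' f) (QuadraticForm.toMatrix' g)

end ConicPencil

/-! The sign of the tact invariant and the vanishing of H and of G depend only on the pencil up to
projective equivalence. If f∘P = a f' + b g' and g∘P = c f' + d g', put D = ad - bc. Then (det P)² Φ
is Φ' after a linear substitution of determinant D, so its discriminant changes by the positive
factor D⁶/(det P)⁸ and its Hessian keeps vanishing or not. G is the trace of a cyclic product of the
tangential matrices (`eval_autopolarTriangle`), which shows its covariance under P; a change of
generators multiplies it by D³.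

It then suffices to show that every pencil reaches some representative
(`reaches_of_isNondegenerate`) and to evaluate the invariants there. A real root of the cubic φ
gives a singular member h. With a kernel vector v of h as first basis vector, h is a nonzero binary
form in y, z. If f(v) ≠ 0, completing the square splits off x², and a pair of binary forms remains
to be reduced (`reaches_block`). If f(v) = 0, then v is a base point and f becomes 2xy + cz²
(`reaches_isotropic`).

Behind the values: the tact invariant is -1/27 times the discriminant of Φ, so its sign counts the
real roots; H = 0 means that Φ is a multiple of a cube; and G = 0 whenever the pencil has a member
of rank one, whose tangential form vanishes. That the nine orbits are distinct is never needed. -/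

namespace ConicPencil

open Matrix

/-! ### Equivalence of generating pairs -/

/-- The pairs `f, g` and `f', g'` generate equivalent pencils: up to an invertible linear
substitution `P`, the first pair is an invertible linear combination of the second one. -/
def PencilEq (f g f' g' : TernaryForm) : Prop :=
  ∃ (P : Matrix (Fin 3) (Fin 3) ℝ) (a b c d : ℝ), P.det ≠ 0 ∧ a * d - b * c ≠ 0 ∧
    (∀ x, f (P *ᵥ x) = a * f' x + b * g' x) ∧ (∀ x, g (P *ᵥ x) = c * f' x + d * g' x)

theorem apply_inv_mulVec {f g f' g' : TernaryForm} {P : Matrix (Fin 3) (Fin 3) ℝ} {a b c d : ℝ}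
    (hP : P.det ≠ 0) (hD : a * d - b * c ≠ 0) (h₁ : ∀ x, f (P *ᵥ x) = a * f' x + b * g' x)
    (h₂ : ∀ x, g (P *ᵥ x) = c * f' x + d * g' x) :
    (∀ x, f' (P⁻¹ *ᵥ x) = d / (a * d - b * c) * f x + -b / (a * d - b * c) * g x) ∧
      ∀ x, g' (P⁻¹ *ᵥ x) = -c / (a * d - b * c) * f x + a / (a * d - b * c) * g x := by
  set D := a * d - b * c with hDdef
  refine ⟨fun x ↦ ?_, fun x ↦ ?_⟩ <;>
  · have e₁ := h₁ (P⁻¹ *ᵥ x)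
    have e₂ := h₂ (P⁻¹ *ᵥ x)
    rw [mulVec_mulVec, mul_nonsing_inv P hP.isUnit, one_mulVec] at e₁ e₂
    rw [e₁, e₂]
    field_simp
    rw [hDdef]
    ring

theorem PencilEq.symm {f g f' g' : TernaryForm} (h : PencilEq f g f' g') :
    PencilEq f' g' f g := by
  obtain ⟨P, a, b, c, d, hP, hD, h₁, h₂⟩ := h
  obtain ⟨e₁, e₂⟩ := apply_inv_mulVec hP hD h₁ h₂
  refine ⟨P⁻¹, _, _, _, _, by simpa using hP, ?_, e₁, e₂⟩
  set D := a * d - b * c with hDdef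
  have : d / D * (a / D) - -b / D * (-c / D) = 1 / D := by
    field_simp
    rw [hDdef]
    ring
  rw [this]
  exact one_div_ne_zero hD

theorem PencilEq.trans {f g f' g' f'' g'' : TernaryForm} (h : PencilEq f g f' g')
    (h' : PencilEq f' g' f'' g'') : PencilEq f g f'' g'' := by
  obtain ⟨P, a, b, c, d, hP, hD, h₁, h₂⟩ := h
  obtain ⟨Q, a', b', c', d', hQ, hD', h₁', h₂'⟩ := h'
  refine ⟨P * Q, a * a' + b * c', a * b' + b * d', c * a' + d * c', c * b' + d * d', ?_, ?_,
    fun x ↦ ?_, fun x ↦ ?_⟩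
  · rw [det_mul]
    exact mul_ne_zero hP hQ
  · have := mul_ne_zero hD hD'
    contrapose! this
    linear_combination this
  · rw [← mulVec_mulVec, h₁, h₁', h₂']
    ring
  · rw [← mulVec_mulVec, h₂, h₁', h₂']
    ring

theorem mem_pencil {f g q : TernaryForm} : q ∈ pencil f g ↔ ∃ a b : ℝ, a • f + b • g = q :=
  Submodule.mem_span_pair

theorem PencilEq.projEquiv {f g f' g' : TernaryForm} (h : PencilEq f g f' g') :
    ProjEquiv (pencil f g) (pencil f' g') := by
  have key {f g f' g' : TernaryForm} {P : Matrix (Fin 3) (Fin 3) ℝ} {a b c d : ℝ}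
      (h₁ : ∀ x, f (P *ᵥ x) = a * f' x + b * g' x) (h₂ : ∀ x, g (P *ᵥ x) = c * f' x + d * g' x)
      {q r : TernaryForm} (hq : q ∈ pencil f g) (hr : ∀ x, r x = q (P *ᵥ x)) :
      r ∈ pencil f' g' := by
    obtain ⟨s, t, rfl⟩ := mem_pencil.1 hq
    refine mem_pencil.2 ⟨s * a + t * c, s * b + t * d, ?_⟩
    ext x
    simp [hr, h₁, h₂]
    ring
  obtain ⟨P, a, b, c, d, hP, hD, h₁, h₂⟩ := h
  have hP' : IsUnit P.det := hP.isUnit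
  obtain ⟨h₁', h₂'⟩ := apply_inv_mulVec hP hD h₁ h₂
  refine ⟨toLin'OfInv (nonsing_inv_mul P hP') (mul_nonsing_inv P hP'), fun q ↦ ⟨fun hq ↦ ?_,
    fun hq ↦ ?_⟩⟩
  · exact key h₁ h₂ hq fun x ↦ by simp [toLin'OfInv]
  · refine key h₁' h₂' hq fun x ↦ ?_
    simp [toLin'OfInv, mul_nonsing_inv P hP']

theorem generatesIn_iff {f g : TernaryForm} (hfg : LinearIndependent ℝ ![f, g]) (o : Orbit) :
    GeneratesIn f g o ↔ PencilEq f g o.rep.1 o.rep.2 := by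
  refine ⟨fun ⟨θ, hθ⟩ ↦ ?_, fun h ↦ h.symm.projEquiv⟩
  have pull {q : TernaryForm} (hq : q ∈ pencil f g) : ∃ a b : ℝ,
      ∀ x, q (LinearMap.toMatrix' (θ.symm : (Fin 3 → ℝ) →ₗ[ℝ] (Fin 3 → ℝ)) *ᵥ x) =
        a * o.rep.1 x + b * o.rep.2 x := by
    have hmem : q.comp (θ.symm : (Fin 3 → ℝ) →ₗ[ℝ] (Fin 3 → ℝ)) ∈ pencil o.rep.1 o.rep.2 := by
      rw [hθ]
      convert hq using 1
      ext x
      simp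
    obtain ⟨a, b, hab⟩ := mem_pencil.1 hmem
    refine ⟨a, b, fun x ↦ ?_⟩
    have := congr($hab x)
    simpa using this.symm
  obtain ⟨a, b, h₁⟩ := pull (Submodule.subset_span (by simp : f ∈ ({f, g} : Set TernaryForm)))
  obtain ⟨c, d, h₂⟩ := pull (Submodule.subset_span (by simp : g ∈ ({f, g} : Set TernaryForm)))
  refine ⟨_, a, b, c, d, ?_, fun h0 ↦ ?_, h₁, h₂⟩
  · rw [LinearMap.det_toMatrix']
    exact θ.symm.isUnit_det'.ne_zero
  have onto (x) : ∃ y, LinearMap.toMatrix' (θ.symm : (Fin 3 → ℝ) →ₗ[ℝ] (Fin 3 → ℝ)) *ᵥ y = x :=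
    ⟨θ x, by simp⟩
  -- If ad = bc, then df = bg and cf = ag. Independence makes all four coefficients zero, whence f =
  -- 0.
  have hli := LinearIndependent.pair_iff.1 hfg
  have e₁ : d • f + (-b) • g = 0 := by
    ext x
    obtain ⟨y, rfl⟩ := onto x
    simp only [_root_.add_apply, _root_.smul_apply, h₁, h₂, smul_eq_mul,
      _root_.zero_apply]
    linear_combination o.rep.1 y * h0
  have e₂ : (-c) • f + a • g = 0 := by
    ext x
    obtain ⟨y, rfl⟩ := onto x
    simp only [_root_.add_apply, _root_.smul_apply, h₁, h₂, smul_eq_mul,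
      _root_.zero_apply]
    linear_combination o.rep.2 y * h0
  obtain ⟨-, hb⟩ := hli _ _ e₁
  obtain ⟨-, ha⟩ := hli _ _ e₂
  have e₃ : (1 : ℝ) • f + (0 : ℝ) • g = 0 := by
    ext x
    obtain ⟨y, rfl⟩ := onto x
    simp only [one_smul, zero_smul, add_zero, h₁, ha, neg_eq_zero.1 hb, zero_mul,
      _root_.zero_apply]
  exact one_ne_zero (hli _ _ e₃).1

/-! ### Forms in coordinates and their symmetric matrices -/

/-- The ternary form with the symmetric matrix `!![a, k, e; k, b, d; e, d, c]`. -/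
def tform (a b c d e k : ℝ) : TernaryForm :=
  a • mono 0 0 + b • mono 1 1 + c • mono 2 2 + (2 * d) • mono 1 2 + (2 * e) • mono 0 2 +
    (2 * k) • mono 0 1

theorem tform_apply (a b c d e k : ℝ) (x : Fin 3 → ℝ) :
    tform a b c d e k x = a * x 0 ^ 2 + b * x 1 ^ 2 + c * x 2 ^ 2 + 2 * d * (x 1 * x 2) +
      2 * e * (x 0 * x 2) + 2 * k * (x 0 * x 1) := by
  simp [tform, mono]
  ring

theorem apply_eq_dotProduct (f : TernaryForm) (x : Fin 3 → ℝ) :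
    f x = x ⬝ᵥ (QuadraticForm.toMatrix' f *ᵥ x) := by
  rw [← toLinearMap₂'_apply', QuadraticForm.toMatrix', Matrix.toLinearMap₂'_toMatrix',
    QuadraticMap.associated_eq_self_apply]

theorem toMatrix'_apply_comm (f : TernaryForm) (i j : Fin 3) :
    QuadraticForm.toMatrix' f i j = QuadraticForm.toMatrix' f j i :=
  (QuadraticForm.isSymm_toMatrix' f).apply j i

theorem eq_tform (f : TernaryForm) : f = tform (QuadraticForm.toMatrix' f 0 0)
    (QuadraticForm.toMatrix' f 1 1) (QuadraticForm.toMatrix' f 2 2)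
    (QuadraticForm.toMatrix' f 1 2) (QuadraticForm.toMatrix' f 0 2)
    (QuadraticForm.toMatrix' f 0 1) := by
  ext x
  rw [tform_apply, apply_eq_dotProduct]
  simp only [dotProduct, mulVec, Fin.sum_univ_three, toMatrix'_apply_comm f 1 0,
    toMatrix'_apply_comm f 2 0, toMatrix'_apply_comm f 2 1]
  ring

theorem toMatrix'_eq_of_apply {f f' g' : TernaryForm} {P : Matrix (Fin 3) (Fin 3) ℝ} {a b : ℝ}
    (h : ∀ x, f (P *ᵥ x) = a * f' x + b * g' x) :
    Pᵀ * QuadraticForm.toMatrix' f * P =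
      a • QuadraticForm.toMatrix' f' + b • QuadraticForm.toMatrix' g' := by
  have e : f.comp (toLin' P) = a • f' + b • g' := by
    ext x
    simp [h]
  have := congr(QuadraticForm.toMatrix' $e)
  rw [QuadraticForm.toMatrix'_comp, LinearMap.toMatrix'_toLin'] at this
  rw [this]
  simp [QuadraticForm.toMatrix']

theorem toMatrix'_tform (a b c d e k : ℝ) : QuadraticForm.toMatrix' (tform a b c d e k) =
    !![a, k, e; k, b, d; e, d, c] := by
  ext i j
  rw [QuadraticForm.toMatrix', LinearMap.toMatrix₂'_apply, QuadraticMap.associated_apply]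
  fin_cases i <;> fin_cases j <;> simp [tform_apply] <;> ring

theorem isNondegenerate_iff {f : TernaryForm} :
    IsNondegenerate f ↔ (QuadraticForm.toMatrix' f).det ≠ 0 := by
  rw [IsNondegenerate, QuadraticForm.toMatrix', ← separatingLeft_iff_det_ne_zero,
    LinearMap.separatingLeft_toMatrix₂'_iff]

/-! ### Invariants of the characteristic form -/

section MixedDet

variable {K : Type*} [CommRing K]

/-- The coefficient of `t² u` in `det (t A + u B)`. -/
def mixedDet (A B : Matrix (Fin 3) (Fin 3) K) : K := (A.adjugate * B).trace

theorem det_smul_add_smul (A B : Matrix (Fin 3) (Fin 3) K) (t u : K) :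
    (t • A + u • B).det =
      A.det * t ^ 3 + mixedDet A B * t ^ 2 * u + mixedDet B A * t * u ^ 2 + B.det * u ^ 3 := by
  simp [mixedDet, det_fin_three, adjugate_fin_three, trace, Fin.sum_univ_three, vecMul, dotProduct]
  ring

theorem mixedDet_map {L : Type*} [CommRing L] (φ : K →+* L) (A B : Matrix (Fin 3) (Fin 3) K) :
    mixedDet (A.map φ) (B.map φ) = φ (mixedDet A B) := by
  simp [mixedDet, adjugate_fin_three, trace, Fin.sum_univ_three, vecMul, dotProduct]

/-- The discriminant of the binary cubic form `p t³ + q t² u + r t u² + s u³`. -/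
def cubicDisc (p q r s : K) : K :=
  q ^ 2 * r ^ 2 - 4 * p * r ^ 3 - 4 * q ^ 3 * s - 27 * p ^ 2 * s ^ 2 + 18 * p * q * r * s

/-- The Hessian determinant of the binary cubic form `p t³ + q t² u + r t u² + s u³`. -/
def cubicHessian (p q r s t u : K) : K :=
  (6 * p * t + 2 * q * u) * (2 * r * t + 6 * s * u) - (2 * q * t + 2 * r * u) ^ 2

end MixedDet

section MvPolynomial

open MvPolynomial

theorem charForm_eq (f g : TernaryForm) : charForm f g =
    C (QuadraticForm.toMatrix' f).det * X 0 ^ 3 +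
    C (mixedDet (QuadraticForm.toMatrix' f) (QuadraticForm.toMatrix' g)) * X 0 ^ 2 * X 1 +
    C (mixedDet (QuadraticForm.toMatrix' g) (QuadraticForm.toMatrix' f)) * X 0 * X 1 ^ 2 +
    C (QuadraticForm.toMatrix' g).det * X 1 ^ 3 := by
  rw [charForm, det_smul_add_smul, mixedDet_map, mixedDet_map, RingHom.map_det, RingHom.map_det]
  rfl

theorem eval_hessian (f g : TernaryForm) (x : Fin 2 → ℝ) : eval x (hessian f g) =
    cubicHessian (QuadraticForm.toMatrix' f).det
      (mixedDet (QuadraticForm.toMatrix' f) (QuadraticForm.toMatrix' g))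
      (mixedDet (QuadraticForm.toMatrix' g) (QuadraticForm.toMatrix' f))
      (QuadraticForm.toMatrix' g).det (x 0) (x 1) := by
  have e₂ (i : Fin 2) : pderiv i (2 : MvPolynomial (Fin 2) ℝ) = 0 := (pderiv i).map_natCast 2
  have e₃ (i : Fin 2) : pderiv i (3 : MvPolynomial (Fin 2) ℝ) = 0 := (pderiv i).map_natCast 3
  simp [hessian, det_fin_two, charForm_eq, Derivation.leibniz, Derivation.leibniz_pow, pderiv_X,
    cubicHessian, e₂, e₃]
  ring

end MvPolynomial

/-- The discriminant of the characteristic form of `f` and `g`. -/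
noncomputable def charDisc (f g : TernaryForm) : ℝ :=
  cubicDisc (QuadraticForm.toMatrix' f).det
    (mixedDet (QuadraticForm.toMatrix' f) (QuadraticForm.toMatrix' g))
    (mixedDet (QuadraticForm.toMatrix' g) (QuadraticForm.toMatrix' f))
    (QuadraticForm.toMatrix' g).det

section Polynomial

open Polynomial

/-- For a cubic, Res(φ, φ') = -Disc(f) times the discriminant, since (-1)^(3·2/2) = -1. The right
side stays meaningful at the representatives, where the first form may be degenerate and the
division by Disc(f) is not. -/
theorem tactInvariant_eq {f : TernaryForm} (hf : IsNondegenerate f) (g : TernaryForm) :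
    tactInvariant f g = -charDisc f g / 27 := by
  have hf' := isNondegenerate_iff.1 hf
  set p := (QuadraticForm.toMatrix' f).det with hp
  set q := mixedDet (QuadraticForm.toMatrix' f) (QuadraticForm.toMatrix' g) with hq
  set r := mixedDet (QuadraticForm.toMatrix' g) (QuadraticForm.toMatrix' f) with hr
  set s := (QuadraticForm.toMatrix' g).det with hs
  have hφ : charPoly f g = C p * X ^ 3 + C q * X ^ 2 + C r * X + C s := by
    simp [charPoly, charForm_eq, ← hp, ← hq, ← hr, ← hs, ← algebraMap_eq]
  have hdeg : (charPoly f g).degree = 3 := by rw [hφ, degree_cubic hf']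
  have hnat : (charPoly f g).natDegree = 3 := by rw [hφ, natDegree_cubic hf']
  have hpos : 0 < (charPoly f g).degree := by rw [hdeg]; norm_num
  have hlead : (charPoly f g).leadingCoeff = p := by rw [hφ, leadingCoeff_cubic hf']
  rw [tactInvariant, natDegree_derivative, resultant_deriv hpos, hnat, hlead,
    discr_of_degree_eq_three hdeg, disc, charDisc, ← hp, ← hq, ← hr, ← hs, hφ, cubicDisc]
  simp [coeff_X, coeff_C]
  field_simp
  ring

end Polynomial

theorem binary_cubic_ext {p q r s p' q' r' s' : ℝ}
    (h : ∀ t u : ℝ, p * t ^ 3 + q * t ^ 2 * u + r * t * u ^ 2 + s * u ^ 3 =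
      p' * t ^ 3 + q' * t ^ 2 * u + r' * t * u ^ 2 + s' * u ^ 3) :
    p = p' ∧ q = q' ∧ r = r' ∧ s = s' := by
  have h₁ := h 1 0
  have h₂ := h 0 1
  have h₃ := h 1 1
  have h₄ := h 1 (-1)
  norm_num at h₁ h₂ h₃ h₄
  refine ⟨?_, ?_, ?_, ?_⟩ <;> linarith

/-- These are the coefficients of (det P)² Φ(t, u) = Φ'(at + cu, bt + du), where Φ' belongs to R, S.
-/
theorem charForm_coeff_transform {A B R S P : Matrix (Fin 3) (Fin 3) ℝ} {a b c d : ℝ}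
    (hA : Pᵀ * A * P = a • R + b • S) (hB : Pᵀ * B * P = c • R + d • S) :
    P.det ^ 2 * A.det = R.det * a ^ 3 + mixedDet R S * a ^ 2 * b + mixedDet S R * a * b ^ 2 +
      S.det * b ^ 3 ∧
    P.det ^ 2 * mixedDet A B = 3 * R.det * a ^ 2 * c + mixedDet R S * (a ^ 2 * d + 2 * a * b * c) +
      mixedDet S R * (2 * a * b * d + b ^ 2 * c) + 3 * S.det * b ^ 2 * d ∧
    P.det ^ 2 * mixedDet B A = 3 * R.det * a * c ^ 2 + mixedDet R S * (2 * a * c * d + b * c ^ 2) +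
      mixedDet S R * (a * d ^ 2 + 2 * b * c * d) + 3 * S.det * b * d ^ 2 ∧
    P.det ^ 2 * B.det = R.det * c ^ 3 + mixedDet R S * c ^ 2 * d + mixedDet S R * c * d ^ 2 +
      S.det * d ^ 3 := by
  refine binary_cubic_ext fun t u ↦ ?_
  have h : Pᵀ * (t • A + u • B) * P = (a * t + c * u) • R + (b * t + d * u) • S := by
    rw [mul_add, add_mul, Matrix.mul_smul, Matrix.mul_smul, Matrix.smul_mul, Matrix.smul_mul,
      hA, hB]
    module
  have h' := congr(($h).det)
  rw [det_mul, det_mul, det_transpose, det_smul_add_smul, det_smul_add_smul] at h'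
  linear_combination h'

/-- The discriminant of a binary cubic has degree 4 in the coefficients and weight 6 under
substitutions. All exponents in the resulting factor are even, so the sign survives. -/
theorem PencilEq.charDisc_eq {f g f' g' : TernaryForm} (h : PencilEq f g f' g') :
    ∃ k : ℝ, 0 < k ∧ charDisc f g = k * charDisc f' g' := by
  obtain ⟨P, a, b, c, d, hP, hD, h₁, h₂⟩ := h
  obtain ⟨e₁, e₂, e₃, e₄⟩ :=
    charForm_coeff_transform (toMatrix'_eq_of_apply h₁) (toMatrix'_eq_of_apply h₂)
  refine ⟨(a * d - b * c) ^ 6 / (P.det ^ 2) ^ 4, by positivity, ?_⟩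
  have e : (P.det ^ 2) ^ 4 * charDisc f g = (a * d - b * c) ^ 6 * charDisc f' g' := by
    have (k p q r s : ℝ) :
        k ^ 4 * cubicDisc p q r s = cubicDisc (k * p) (k * q) (k * r) (k * s) := by
      simp only [cubicDisc]
      ring
    rw [charDisc, this, e₁, e₂, e₃, e₄, charDisc]
    simp only [cubicDisc]
    ring
  rw [div_mul_eq_mul_div, ← e]
  field_simp

theorem PencilEq.hessian_eq_zero {f g f' g' : TernaryForm} (h : PencilEq f g f' g')
    (h0 : hessian f' g' = 0) : hessian f g = 0 := by
  obtain ⟨P, a, b, c, d, hP, hD, h₁, h₂⟩ := h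
  obtain ⟨e₁, e₂, e₃, e₄⟩ :=
    charForm_coeff_transform (toMatrix'_eq_of_apply h₁) (toMatrix'_eq_of_apply h₂)
  refine MvPolynomial.funext fun x ↦ ?_
  have key := eval_hessian f' g' ![a * x 0 + c * x 1, b * x 0 + d * x 1]
  rw [h0, map_zero] at key
  rw [map_zero, eval_hessian]
  refine (mul_eq_zero.1 ?_).resolve_left (pow_ne_zero 2 (pow_ne_zero 2 hP))
  have (k p q r s t u : ℝ) :
      k ^ 2 * cubicHessian p q r s t u = cubicHessian (k * p) (k * q) (k * r) (k * s) t u := by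
    simp only [cubicHessian]
    ring
  rw [this, e₁, e₂, e₃, e₄]
  simp only [cubicHessian, cons_val_zero, cons_val_one] at key ⊢
  linear_combination -(a * d - b * c) ^ 2 * key

/-! ### The autopolar triangle covariant -/

section Autopolar

variable {K : Type*} [CommRing K]

/-- The matrix of the alternating form `(u, v) ↦ det (u, p, v)`. -/
def crossMatrix (p : Fin 3 → K) : Matrix (Fin 3) (Fin 3) K :=
  !![0, -p 2, p 1; p 2, 0, -p 0; -p 1, p 0, 0]

/-- For invertible Q this is det(Qu, p, Qv) = det Q · det(u, Q⁻¹p, v); the adjugate absorbs the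
factor det Q. -/
theorem transpose_mul_crossMatrix_mul (Q : Matrix (Fin 3) (Fin 3) K) (p : Fin 3 → K) :
    Qᵀ * crossMatrix p * Q = crossMatrix (Q.adjugate *ᵥ p) := by
  ext i j
  fin_cases i <;> fin_cases j <;>
    simp [crossMatrix, mul_apply, mulVec, dotProduct, Fin.sum_univ_three, adjugate_fin_three] <;>
    ring

/-- Both sides are trilinear in S, T, U. On squares pᵢpᵢᵀ the trace factors into the det(pᵢ, p, pⱼ),
the equations of the sides of the triangle. The trace form makes the covariance visible. -/
theorem eval_minorCubic {S T U : Matrix (Fin 3) (Fin 3) K} (hS : S.IsSymm) (hT : T.IsSymm)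
    (hU : U.IsSymm) (p : Fin 3 → K) :
    MvPolynomial.eval p (minorCubic (of ![symEntries S, symEntries T, symEntries U])
      (MvPolynomial.X 0) (MvPolynomial.X 1) (MvPolynomial.X 2)) =
    (S * crossMatrix p * T * crossMatrix p * U * crossMatrix p).trace := by
  simp [minorCubic, minor, symEntries, crossMatrix, det_fin_three, trace, mul_apply,
    Fin.sum_univ_three, hS.apply 0 1, hS.apply 0 2, hS.apply 1 2, hT.apply 0 1, hT.apply 0 2,
    hT.apply 1 2, hU.apply 0 1, hU.apply 0 2, hU.apply 1 2]
  ring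

theorem isSymm_tangential {A : Matrix (Fin 3) (Fin 3) K} (hA : A.IsSymm) :
    (tangential A).IsSymm := by
  rw [IsSymm, tangential, adjugate_transpose, hA.eq]

theorem isSymm_omega {A B : Matrix (Fin 3) (Fin 3) K} (hA : A.IsSymm) (hB : B.IsSymm) :
    (omega A B).IsSymm :=
  ((isSymm_tangential (hA.add hB)).sub (isSymm_tangential hA)).sub (isSymm_tangential hB)

theorem eval_autopolarTriangle {A B : Matrix (Fin 3) (Fin 3) K} (hA : A.IsSymm) (hB : B.IsSymm)
    (p : Fin 3 → K) : MvPolynomial.eval p (autopolarTriangle A B) =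
      (tangential A * crossMatrix p * omega A B * crossMatrix p * tangential B *
        crossMatrix p).trace :=
  eval_minorCubic (isSymm_tangential hA) (isSymm_omega hA hB) (isSymm_tangential hB) p

theorem tangential_congr (P A : Matrix (Fin 3) (Fin 3) K) :
    tangential (Pᵀ * A * P) = P.adjugate * tangential A * P.adjugateᵀ := by
  rw [tangential, adjugate_mul_distrib, adjugate_mul_distrib, adjugate_transpose, tangential,
    mul_assoc]

theorem omega_congr (P A B : Matrix (Fin 3) (Fin 3) K) :
    omega (Pᵀ * A * P) (Pᵀ * B * P) = P.adjugate * omega A B * P.adjugateᵀ := by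
  rw [omega, ← add_mul, ← mul_add, tangential_congr, tangential_congr, tangential_congr, omega,
    mul_sub, mul_sub, sub_mul, sub_mul]

theorem eval_autopolarTriangle_congr {A B : Matrix (Fin 3) (Fin 3) K} (hA : A.IsSymm)
    (hB : B.IsSymm) (P : Matrix (Fin 3) (Fin 3) K) (p : Fin 3 → K) :
    MvPolynomial.eval p (autopolarTriangle (Pᵀ * A * P) (Pᵀ * B * P)) =
      MvPolynomial.eval (P.det • P *ᵥ p) (autopolarTriangle A B) := by
  have hs {S : Matrix (Fin 3) (Fin 3) K} (hS : S.IsSymm) : (Pᵀ * S * P).IsSymm := by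
    simp [IsSymm, hS.eq, mul_assoc]
  have hx : crossMatrix (P.det • P *ᵥ p) = P.adjugateᵀ * crossMatrix p * P.adjugate := by
    -- In dimension 3 the adjugate of the adjugate is det P · P.
    rw [transpose_mul_crossMatrix_mul, adjugate_adjugate P (by simp)]
    simp [smul_mulVec]
  rw [eval_autopolarTriangle (hs hA) (hs hB), eval_autopolarTriangle hA hB, tangential_congr,
    tangential_congr, omega_congr, hx]
  simp only [mul_assoc]
  rw [trace_mul_comm]
  simp only [mul_assoc]

theorem minorCubic_mul (W : Matrix (Fin 3) (Fin 3) K) (M : Matrix (Fin 3) (Fin 6) K)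
    (x y z : MvPolynomial (Fin 3) K) :
    minorCubic (W * M) x y z = MvPolynomial.C W.det * minorCubic M x y z := by
  have h (i j k : Fin 6) : minor (W * M) i j k = MvPolynomial.C W.det * minor M i j k := by
    rw [minor, minor, ← map_mul, ← det_mul]
    congr 2
  simp only [minorCubic, h]
  ring

theorem tangential_smul_add_smul (R S : Matrix (Fin 3) (Fin 3) K) (a b : K) :
    tangential (a • R + b • S) =
      a ^ 2 • tangential R + (a * b) • omega R S + b ^ 2 • tangential S := by
  ext i j
  fin_cases i <;> fin_cases j <;> simp [omega, tangential, adjugate_fin_three] <;> ring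

theorem omega_smul_add_smul (R S : Matrix (Fin 3) (Fin 3) K) (a b c d : K) :
    omega (a • R + b • S) (c • R + d • S) =
      (2 * a * c) • tangential R + (a * d + b * c) • omega R S + (2 * b * d) • tangential S := by
  have h : a • R + b • S + (c • R + d • S) = (a + c) • R + (b + d) • S := by module
  rw [omega, h, tangential_smul_add_smul, tangential_smul_add_smul, tangential_smul_add_smul]
  module

theorem symEntries_smul_add_smul_add_smul (S T U : Matrix (Fin 3) (Fin 3) K) (a b c : K) :
    symEntries (a • S + b • T + c • U) =
      a • symEntries S + b • symEntries T + c • symEntries U := by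
  ext i
  fin_cases i <;> simp [symEntries]

/-- The rows of M transform by the symmetric square of the matrix with rows (a, b), (c, d). Its
determinant is (ad - bc)³, and every maximal minor is multiplied by it. -/
theorem autopolarTriangle_smul_add_smul (R S : Matrix (Fin 3) (Fin 3) K) (a b c d : K) :
    autopolarTriangle (a • R + b • S) (c • R + d • S) =
      MvPolynomial.C (a * d - b * c) ^ 3 * autopolarTriangle R S := by
  have h : autopolarMatrix (a • R + b • S) (c • R + d • S) =
      !![a ^ 2, a * b, b ^ 2; 2 * a * c, a * d + b * c, 2 * b * d; c ^ 2, c * d, d ^ 2] *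
        autopolarMatrix R S := by
    rw [autopolarMatrix, tangential_smul_add_smul, tangential_smul_add_smul, omega_smul_add_smul]
    simp only [symEntries_smul_add_smul_add_smul]
    ext i j
    fin_cases i <;> simp [autopolarMatrix, mul_apply, Fin.sum_univ_three]
  rw [autopolarTriangle, h, minorCubic_mul, ← map_pow, autopolarTriangle]
  congr 2
  simp [det_fin_three]
  ring

end Autopolar

theorem PencilEq.covariantG_eq_zero {f g f' g' : TernaryForm} (h : PencilEq f g f' g')
    (h0 : covariantG f' g' = 0) : covariantG f g = 0 := by
  obtain ⟨P, a, b, c, d, hP, hD, h₁, h₂⟩ := h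
  have key := autopolarTriangle_smul_add_smul (QuadraticForm.toMatrix' f')
    (QuadraticForm.toMatrix' g') a b c d
  rw [← covariantG, h0, mul_zero, ← toMatrix'_eq_of_apply h₁, ← toMatrix'_eq_of_apply h₂] at key
  refine MvPolynomial.funext fun x ↦ ?_
  -- The point is chosen so that det P · P sends it to x.
  have e := eval_autopolarTriangle_congr (QuadraticForm.isSymm_toMatrix' f)
    (QuadraticForm.isSymm_toMatrix' g) P (P.det⁻¹ • P⁻¹ *ᵥ x)
  rw [key, map_zero, mulVec_smul, smul_smul, mul_inv_cancel₀ hP, one_smul, mulVec_mulVec,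
    mul_nonsing_inv P hP.isUnit, one_mulVec] at e
  rw [map_zero, covariantG, ← e]

/-! ### Reduction to normal forms -/

/-- The pair `f, g` is equivalent to one of Levy's representatives. -/
def Reaches (f g : TernaryForm) : Prop := ∃ o : Orbit, PencilEq f g o.rep.1 o.rep.2

theorem PencilEq.reaches {f g f' g' : TernaryForm} (h : PencilEq f g f' g')
    (h' : Reaches f' g') : Reaches f g :=
  h'.imp fun _ ho ↦ h.trans ho

theorem exists_mul_sq_eq {b c : ℝ} (h : 0 < b * c) : ∃ κ : ℝ, κ ≠ 0 ∧ c * κ ^ 2 = b := by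
  have hb : b ≠ 0 := by rintro rfl; simp at h
  have hc : c ≠ 0 := by rintro rfl; simp at h
  have h' : 0 < b / c := by
    rw [← mul_div_mul_right b c hc]
    exact div_pos h (mul_self_pos.2 hc)
  exact ⟨√(b / c), (Real.sqrt_pos.2 h').ne', by rw [Real.sq_sqrt h'.le]; field_simp⟩

theorem exists_mul_sq_eq_neg {b c : ℝ} (h : b * c < 0) : ∃ κ : ℝ, κ ≠ 0 ∧ c * κ ^ 2 = -b :=
  exists_mul_sq_eq (by linarith : 0 < -b * c)

theorem pencilEq_swap_one_two (a b c d e k a' b' c' d' e' k' : ℝ) :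
    PencilEq (tform a b c d e k) (tform a' b' c' d' e' k')
      (tform a c b d k e) (tform a' c' b' d' k' e') := by
  refine ⟨!![1, 0, 0; 0, 0, 1; 0, 1, 0], 1, 0, 0, 1, by simp [det_fin_three], by simp, fun x ↦ ?_,
    fun x ↦ ?_⟩ <;>
  · simp [tform_apply, dotProduct, Fin.sum_univ_three]
    ring

theorem pencilEq_swap_zero_one (a b c d e k a' b' c' d' e' k' : ℝ) :
    PencilEq (tform a b c d e k) (tform a' b' c' d' e' k')
      (tform b a c e d k) (tform b' a' c' e' d' k') := by
  refine ⟨!![0, 1, 0; 1, 0, 0; 0, 0, 1], 1, 0, 0, 1, by simp [det_fin_three], by simp, fun x ↦ ?_,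
    fun x ↦ ?_⟩ <;>
  · simp [tform_apply, dotProduct, Fin.sum_univ_three]
    ring

theorem reaches_double_line {a b c : ℝ} (ha : a ≠ 0) (hb : b ≠ 0) (hc : c ≠ 0) :
    Reaches (tform 0 b c 0 0 0) (tform a 0 0 0 0 0) := by
  rcases (mul_ne_zero hb hc).lt_or_gt with h | h
  · obtain ⟨κ, hκ, e⟩ := exists_mul_sq_eq_neg h
    refine ⟨.III, !![0, 1, 0; 1, 0, 1; κ, 0, -κ], 4 * b, 0, 0, a, ?_, by simp [ha, hb],
      fun x ↦ ?_, fun x ↦ ?_⟩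
    · simp [det_fin_three]
      contrapose! hκ
      linarith
    · simp [tform_apply, dotProduct, Fin.sum_univ_three, Orbit.rep, mono,
        -mul_eq_mul_left_iff]
      linear_combination (x 0 - x 2) ^ 2 * e
    · simp [tform_apply, dotProduct, Fin.sum_univ_three, Orbit.rep, mono,
        -mul_eq_mul_left_iff]
      ring
  · obtain ⟨κ, hκ, e⟩ := exists_mul_sq_eq h
    refine ⟨.IIIa, !![0, 0, 1; 1, 0, 0; 0, κ, 0], b, 0, 0, a, by simp [det_fin_three, hκ],
      by simp [ha, hb], fun x ↦ ?_, fun x ↦ ?_⟩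
    · simp [tform_apply, dotProduct, Fin.sum_univ_three, Orbit.rep, mono,
        -mul_eq_mul_left_iff]
      linear_combination x 1 ^ 2 * e
    · simp [tform_apply, dotProduct, Fin.sum_univ_three, Orbit.rep, mono,
        -mul_eq_mul_left_iff]
      ring

/-! ### Simultaneously diagonal pencils -/

/-- The vector n is the cross product of the two coefficient vectors. Rescaling the squares by n₁²,
n₁n₂, n₁n₃ gives both forms coefficient sum n₁(n·a) = 0 and n₁(n·b) = 0, so they lie in the span of
x² - y² and x² - z². -/
theorem reaches_diagonal_of_pos {a₁ a₂ a₃ b₁ b₂ b₃ : ℝ}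
    (h₂ : 0 < (a₂ * b₃ - a₃ * b₂) * (a₃ * b₁ - a₁ * b₃))
    (h₃ : 0 < (a₂ * b₃ - a₃ * b₂) * (a₁ * b₂ - a₂ * b₁)) :
    Reaches (tform a₁ a₂ a₃ 0 0 0) (tform b₁ b₂ b₃ 0 0 0) := by
  set n₁ := a₂ * b₃ - a₃ * b₂ with hn₁
  set n₂ := a₃ * b₁ - a₁ * b₃ with hn₂
  set n₃ := a₁ * b₂ - a₂ * b₁ with hn₃
  have h₁ : n₁ ≠ 0 := left_ne_zero_of_mul h₂.ne'
  have s₂ : √(n₁ * n₂) ^ 2 = n₁ * n₂ := Real.sq_sqrt h₂.le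
  have s₃ : √(n₁ * n₃) ^ 2 = n₁ * n₃ := Real.sq_sqrt h₃.le
  have p₂ := (Real.sqrt_pos.2 h₂).ne'
  have p₃ := (Real.sqrt_pos.2 h₃).ne'
  refine ⟨.I, !![n₁, 0, 0; 0, √(n₁ * n₂), 0; 0, 0, √(n₁ * n₃)], -(a₂ * (n₁ * n₂)),
    -(a₃ * (n₁ * n₃)), -(b₂ * (n₁ * n₂)), -(b₃ * (n₁ * n₃)), ?_, ?_, fun x ↦ ?_, fun x ↦ ?_⟩
  · simp only [det_fin_three]
    simpa using ⟨⟨h₁, p₂⟩, p₃⟩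
  · have : -(a₂ * (n₁ * n₂)) * -(b₃ * (n₁ * n₃)) - -(a₃ * (n₁ * n₃)) * -(b₂ * (n₁ * n₂)) =
        n₁ * n₂ * (n₁ * n₃) * n₁ := by
      rw [hn₁]
      ring
    rw [this]
    exact mul_ne_zero (mul_ne_zero h₂.ne' h₃.ne') h₁
  · simp [tform_apply, dotProduct, Fin.sum_univ_three, Orbit.rep, mono, -mul_eq_mul_left_iff,
      mul_pow, s₂, s₃]
    rw [hn₁, hn₂, hn₃]
    ring
  · simp [tform_apply, dotProduct, Fin.sum_univ_three, Orbit.rep, mono, -mul_eq_mul_left_iff,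
      mul_pow, s₂, s₃]
    rw [hn₁, hn₂, hn₃]
    ring

theorem reaches_diagonal_of_neg_last {a₁ a₂ a₃ b₁ b₂ b₃ : ℝ}
    (h₂ : 0 < (a₂ * b₃ - a₃ * b₂) * (a₃ * b₁ - a₁ * b₃))
    (h₃ : (a₂ * b₃ - a₃ * b₂) * (a₁ * b₂ - a₂ * b₁) < 0) :
    Reaches (tform a₁ a₂ a₃ 0 0 0) (tform b₁ b₂ b₃ 0 0 0) := by
  refine PencilEq.reaches (f' := tform 1 (-1) 0 0 0 0) (g' := tform 1 0 1 0 0 0) ?_ ?_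
  · set n₁ := a₂ * b₃ - a₃ * b₂ with hn₁
    set n₂ := a₃ * b₁ - a₁ * b₃ with hn₂
    set n₃ := a₁ * b₂ - a₂ * b₁ with hn₃
    have h₁ : n₁ ≠ 0 := left_ne_zero_of_mul h₂.ne'
    have h₃' : 0 < -(n₁ * n₃) := by linarith
    have s₂ : √(n₁ * n₂) ^ 2 = n₁ * n₂ := Real.sq_sqrt h₂.le
    have s₃ : √(-(n₁ * n₃)) ^ 2 = -(n₁ * n₃) := Real.sq_sqrt h₃'.le
    have p₂ := (Real.sqrt_pos.2 h₂).ne'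
    have p₃ := (Real.sqrt_pos.2 h₃').ne'
    refine ⟨!![n₁, 0, 0; 0, √(n₁ * n₂), 0; 0, 0, √(-(n₁ * n₃))], -(a₂ * (n₁ * n₂)),
      -(a₃ * (n₁ * n₃)), -(b₂ * (n₁ * n₂)), -(b₃ * (n₁ * n₃)), ?_, ?_, fun x ↦ ?_, fun x ↦ ?_⟩
    · simp only [det_fin_three]
      simpa using ⟨⟨h₁, p₂⟩, p₃⟩
    · have : -(a₂ * (n₁ * n₂)) * -(b₃ * (n₁ * n₃)) - -(a₃ * (n₁ * n₃)) * -(b₂ * (n₁ * n₂)) =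
          n₁ * n₂ * (n₁ * n₃) * n₁ := by
        rw [hn₁]
        ring
      rw [this]
      exact mul_ne_zero (mul_ne_zero h₂.ne' h₃.ne) h₁
    · simp [tform_apply, dotProduct, Fin.sum_univ_three, mul_pow, s₂, s₃]
      rw [hn₁, hn₂, hn₃]
      ring
    · simp [tform_apply, dotProduct, Fin.sum_univ_three, mul_pow, s₂, s₃]
      rw [hn₁, hn₂, hn₃]
      ring
  -- With x + z, x - z, y as the old coordinates, the forms become 4xz and x² + y² + z² + 2xz.
  · refine ⟨.Ia, !![1, 0, 1; 1, 0, -1; 0, 1, 0], 0, 4, 1, 2, by simp [det_fin_three],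
      by norm_num, fun x ↦ ?_, fun x ↦ ?_⟩ <;>
    · simp [tform_apply, dotProduct, Fin.sum_univ_three, Orbit.rep, mono,
        -mul_eq_mul_left_iff]
      ring

/-- Base points satisfy x² : y² : z² = n₁ : n₂ : n₃. Equal signs give orbit I; otherwise a
permutation moves the odd sign to the last place. A transposition negates n besides permuting it,
which leaves the products nᵢnⱼ unaffected. -/
theorem reaches_diagonal {a₁ a₂ a₃ b₁ b₂ b₃ : ℝ} (h₁ : a₂ * b₃ - a₃ * b₂ ≠ 0)
    (h₂ : a₃ * b₁ - a₁ * b₃ ≠ 0) (h₃ : a₁ * b₂ - a₂ * b₁ ≠ 0) :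
    Reaches (tform a₁ a₂ a₃ 0 0 0) (tform b₁ b₂ b₃ 0 0 0) := by
  have neg_middle {a₁ a₂ a₃ b₁ b₂ b₃ : ℝ}
      (h₂ : (a₂ * b₃ - a₃ * b₂) * (a₃ * b₁ - a₁ * b₃) < 0)
      (h₃ : 0 < (a₂ * b₃ - a₃ * b₂) * (a₁ * b₂ - a₂ * b₁)) :
      Reaches (tform a₁ a₂ a₃ 0 0 0) (tform b₁ b₂ b₃ 0 0 0) :=
    (pencilEq_swap_one_two ..).reaches
      (reaches_diagonal_of_neg_last (by linarith) (by linarith))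
  rcases (mul_ne_zero h₁ h₂).lt_or_gt with h₁₂ | h₁₂ <;>
    rcases (mul_ne_zero h₁ h₃).lt_or_gt with h₁₃ | h₁₃
  · have h₂₃ := mul_pos_of_neg_of_neg h₁₂ h₁₃
    have : 0 < (a₃ * b₁ - a₁ * b₃) * (a₁ * b₂ - a₂ * b₁) := by
      refine pos_of_mul_pos_right (a := (a₂ * b₃ - a₃ * b₂) ^ 2) ?_ (sq_nonneg _)
      linarith
    exact (pencilEq_swap_zero_one ..).reaches (neg_middle (by linarith) (by linarith))
  · exact neg_middle h₁₂ h₁₃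
  · exact reaches_diagonal_of_neg_last h₁₂ h₁₃
  · exact reaches_diagonal_of_pos h₁₂ h₁₃

theorem reaches_diagonal_block {a b c b' c' : ℝ} (ha : a ≠ 0) (hb' : b' ≠ 0)
    (hc : c' = 0 → c ≠ 0) : Reaches (tform a b c 0 0 0) (tform 0 b' c' 0 0 0) := by
  by_cases hc' : c' = 0
  · subst hc'
    refine PencilEq.reaches ?_ (reaches_double_line hb' ha (hc rfl))
    refine ⟨!![0, 1, 0; 1, 0, 0; 0, 0, 1], 1, b / b', 0, 1, by simp [det_fin_three], by simp,
      fun x ↦ ?_, fun x ↦ ?_⟩ <;>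
    · simp [tform_apply, dotProduct, Fin.sum_univ_three]
      try field_simp
      try ring
  by_cases h : b * c' - c * b' = 0
  · refine PencilEq.reaches ?_ (reaches_double_line ha hb' hc')
    refine ⟨1, b / b', 1, 1, 0, by simp, by simp, fun x ↦ ?_, fun x ↦ ?_⟩
    · simp [tform_apply]
      field_simp
      linear_combination -(x 2) ^ 2 * h
    · simp [tform_apply]
  · exact reaches_diagonal h (by simp [ha, hc']) (by simp [ha, hb'])

/-! ### Splitting off x²: pairs of binary forms -/

theorem reaches_line_pair {a c : ℝ} (ha : a ≠ 0) (hc : c ≠ 0) :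
    Reaches (tform a 0 c 0 0 0) (tform 0 0 0 (1 / 2) 0 0) := by
  rcases (mul_ne_zero ha hc).lt_or_gt with h | h
  · obtain ⟨κ, hκ, e⟩ := exists_mul_sq_eq_neg h
    refine ⟨.II, !![0, 1, 1; 1, 0, 0; 0, κ, -κ], 4 * a, 0, 0, κ, ?_, by simp [ha, hκ],
      fun x ↦ ?_, fun x ↦ ?_⟩
    · simp [det_fin_three]
      contrapose! hκ
      linarith
    · simp [tform_apply, dotProduct, Fin.sum_univ_three, Orbit.rep, mono,
        -mul_eq_mul_left_iff]
      linear_combination (x 1 - x 2) ^ 2 * e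
    · simp [tform_apply, dotProduct, Fin.sum_univ_three, Orbit.rep, mono,
        -mul_eq_mul_left_iff]
      ring
  · obtain ⟨κ, hκ, e⟩ := exists_mul_sq_eq h
    refine ⟨.IIa, !![0, 1, 0; 1, 0, 0; 0, 0, κ], a, 0, 0, κ, by simp [det_fin_three, hκ],
      by simp [ha, hκ], fun x ↦ ?_, fun x ↦ ?_⟩
    · simp [tform_apply, dotProduct, Fin.sum_univ_three, Orbit.rep, mono,
        -mul_eq_mul_left_iff]
      linear_combination x 2 ^ 2 * e
    · simp [tform_apply, dotProduct, Fin.sum_univ_three, Orbit.rep, mono,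
        -mul_eq_mul_left_iff]
      ring

theorem reaches_complex_pair {a b c : ℝ} (ha : a ≠ 0) (h : b * c < 0) :
    Reaches (tform a b c 0 0 0) (tform 0 0 0 (1 / 2) 0 0) := by
  have aux {a b c : ℝ} (hab : 0 < a * b) (hac : a * c < 0) :
      Reaches (tform a b c 0 0 0) (tform 0 0 0 (1 / 2) 0 0) := by
    have ha : a ≠ 0 := left_ne_zero_of_mul hab.ne'
    obtain ⟨κ, hκ, e⟩ := exists_mul_sq_eq hab
    obtain ⟨l, hl, e'⟩ := exists_mul_sq_eq_neg hac
    refine ⟨.Ib, !![0, 1, 0; κ, 0, 0; 0, 0, l], a, 0, 0, κ * l, by simp [det_fin_three, hκ, hl],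
      by simp [ha, hκ, hl], fun x ↦ ?_, fun x ↦ ?_⟩
    · simp [tform_apply, dotProduct, Fin.sum_univ_three, Orbit.rep, mono,
        -mul_eq_mul_left_iff]
      linear_combination x 0 ^ 2 * e + x 2 ^ 2 * e'
    · simp [tform_apply, dotProduct, Fin.sum_univ_three, Orbit.rep, mono,
        -mul_eq_mul_left_iff]
      ring
  have hb : b ≠ 0 := left_ne_zero_of_mul h.ne
  have hneg : a * b * (a * c) < 0 := by
    have : 0 < a ^ 2 := by positivity
    nlinarith
  rcases (mul_ne_zero ha hb).lt_or_gt with hab | hab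
  · exact (pencilEq_swap_one_two ..).reaches (aux (pos_of_mul_neg_right hneg hab.le) hab)
  · exact aux hab (neg_of_mul_neg_right hneg hab.le)

/-- The block of tf + u·yz has determinant bct² - u²/4, so the sign of bc tells distinct real,
double and complex roots apart. -/
theorem reaches_yz {a : ℝ} (ha : a ≠ 0) (b c : ℝ) :
    Reaches (tform a b c 0 0 0) (tform 0 0 0 (1 / 2) 0 0) := by
  rcases eq_or_ne b 0 with rfl | hb <;> rcases eq_or_ne c 0 with rfl | hc
  · refine ⟨.III, !![0, 1, 0; 1, 0, 0; 0, 0, 1], 0, a, 1, 0, by simp [det_fin_three],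
      by simp [ha], fun x ↦ ?_, fun x ↦ ?_⟩ <;>
    · simp [tform_apply, dotProduct, Fin.sum_univ_three, Orbit.rep, mono,
        -mul_eq_mul_left_iff]
      try ring
  · exact reaches_line_pair ha hc
  · exact (pencilEq_swap_one_two ..).reaches (reaches_line_pair ha hb)
  rcases (mul_ne_zero hb hc).lt_or_gt with h | h
  · exact reaches_complex_pair ha h
  obtain ⟨κ, hκ, e⟩ := exists_mul_sq_eq h
  refine PencilEq.reaches ?_ (reaches_diagonal_block (a := a) (b := 2 * b) (c := 2 * b) (b' := κ)
    (c' := -κ) ha hκ (by simp [hκ]))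
  -- For bc > 0 this substitution turns yz into κ(y² - z²) and by² + cz² into 2b(y² + z²).
  refine ⟨!![1, 0, 0; 0, 1, 1; 0, κ, -κ], 1, 0, 0, 1, ?_, by simp, fun x ↦ ?_, fun x ↦ ?_⟩
  · simp [det_fin_three]
    contrapose! hκ
    linarith
  · simp [tform_apply, dotProduct, Fin.sum_univ_three]
    linear_combination (x 1 - x 2) ^ 2 * e
  · simp [tform_apply, dotProduct, Fin.sum_univ_three]
    ring

theorem reaches_osculating {a d b' : ℝ} (ha : a ≠ 0) (hd : d ≠ 0) (hb' : b' ≠ 0) (b : ℝ) :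
    Reaches (tform a b 0 d 0 0) (tform 0 b' 0 0 0 0) := by
  refine ⟨.V, !![0, 1, 0; 1, 0, 0; 0, 0, -a / (2 * d)], -a, b, 0, b',
    by simp [det_fin_three, ha, hd], by simp [ha, hb'], fun x ↦ ?_, fun x ↦ ?_⟩ <;>
  · simp [tform_apply, dotProduct, Fin.sum_univ_three, Orbit.rep, mono,
        -mul_eq_mul_left_iff]
    field_simp
    try ring

theorem reaches_definite_block {a : ℝ} (ha : a ≠ 0) (b c d : ℝ) :
    Reaches (tform a b c d 0 0) (tform 0 1 1 0 0 0) := by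
  rcases eq_or_ne d 0 with rfl | hd
  · exact reaches_diagonal_block ha one_ne_zero (by simp)
  -- The equation says that (d, t) is an eigenvector of the block with rows (b, d), (d, c), with
  -- eigenvalue b + t; (-t, d) is orthogonal to it.
  obtain ⟨t, ht⟩ : ∃ t : ℝ, t ^ 2 = (c - b) * t + d ^ 2 := by
    refine ⟨((c - b) + √((c - b) ^ 2 + 4 * d ^ 2)) / 2, ?_⟩
    have := Real.sq_sqrt (by positivity : 0 ≤ (c - b) ^ 2 + 4 * d ^ 2)
    linear_combination this / 4
  have hdt : d ^ 2 + t ^ 2 ≠ 0 := by positivity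
  refine PencilEq.reaches ?_ (reaches_diagonal_block (a := a)
    (b := b * d ^ 2 + c * t ^ 2 + 2 * d ^ 2 * t) (c := b * t ^ 2 + c * d ^ 2 - 2 * d ^ 2 * t)
    (b' := d ^ 2 + t ^ 2) (c' := d ^ 2 + t ^ 2) ha hdt fun h ↦ absurd h hdt)
  refine ⟨!![1, 0, 0; 0, d, -t; 0, t, d], 1, 0, 0, 1, ?_, by simp, fun x ↦ ?_, fun x ↦ ?_⟩
  · simp [det_fin_three]
    contrapose! hdt
    linarith
  · simp [tform_apply, dotProduct, Fin.sum_univ_three]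
    linear_combination -2 * d * x 1 * x 2 * ht
  · simp [tform_apply, dotProduct, Fin.sum_univ_three]
    ring

theorem reaches_block_of_diagonal {a b c d b' m : ℝ} (ha : a ≠ 0) (hb' : b' ≠ 0)
    (h : c ≠ 0 ∨ d ≠ 0) : Reaches (tform a b c d 0 0) (tform 0 b' m 0 0 0) := by
  rcases eq_or_ne m 0 with rfl | hm
  · rcases eq_or_ne c 0 with rfl | hc
    · exact reaches_osculating ha (by simpa using h) hb' b
    · refine PencilEq.reaches ?_ (reaches_diagonal_block (a := a) (b := b - d ^ 2 / c) (c := c)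
        (b' := b') (c' := 0) ha hb' fun _ ↦ hc)
      refine ⟨!![1, 0, 0; 0, 1, 0; 0, -d / c, 1], 1, 0, 0, 1, by simp [det_fin_three], by simp,
        fun x ↦ ?_, fun x ↦ ?_⟩ <;>
      · simp [tform_apply, dotProduct, Fin.sum_univ_three]
        try field_simp
        try ring
  rcases (mul_ne_zero hb' hm).lt_or_gt with hneg | hpos
  · obtain ⟨κ, hκ, e⟩ := exists_mul_sq_eq_neg hneg
    refine PencilEq.reaches ?_ (reaches_yz ha (b + c * κ ^ 2 + 2 * d * κ)
      (b + c * κ ^ 2 - 2 * d * κ))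
    refine ⟨!![1, 0, 0; 0, 1, 1; 0, κ, -κ], 1, 2 * b - 2 * c * κ ^ 2, 0, 4 * b', ?_, by simp [hb'],
      fun x ↦ ?_, fun x ↦ ?_⟩
    · simp [det_fin_three]
      contrapose! hκ
      linarith
    · simp [tform_apply, dotProduct, Fin.sum_univ_three]
      ring
    · simp [tform_apply, dotProduct, Fin.sum_univ_three]
      linear_combination (x 1 - x 2) ^ 2 * e
  · obtain ⟨κ, hκ, e⟩ := exists_mul_sq_eq hpos
    refine PencilEq.reaches ?_ (reaches_definite_block ha b (c * κ ^ 2) (d * κ))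
    refine ⟨!![1, 0, 0; 0, 1, 0; 0, 0, κ], 1, 0, 0, b', by simp [det_fin_three, hκ], by simp [hb'],
      fun x ↦ ?_, fun x ↦ ?_⟩
    · simp [tform_apply, dotProduct, Fin.sum_univ_three]
      ring
    · simp [tform_apply, dotProduct, Fin.sum_univ_three]
      linear_combination x 2 ^ 2 * e

theorem reaches_block {a b c d b' c' d' : ℝ} (ha : a ≠ 0) (hf : b * c - d ^ 2 ≠ 0)
    (hh : ¬(b' = 0 ∧ c' = 0 ∧ d' = 0)) :
    Reaches (tform a b c d 0 0) (tform 0 b' c' d' 0 0) := by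
  have aux {b c d b' c' d' : ℝ} (hf : b * c - d ^ 2 ≠ 0) (hb' : b' ≠ 0) :
      Reaches (tform a b c d 0 0) (tform 0 b' c' d' 0 0) := by
    refine PencilEq.reaches ?_ (reaches_block_of_diagonal (b := b)
      (c := c - 2 * d * (d' / b') + b * (d' / b') ^ 2) (d := d - b * (d' / b')) (b' := b')
      (m := c' - d' ^ 2 / b') ha hb' ?_)
    · refine ⟨!![1, 0, 0; 0, 1, -(d' / b'); 0, 0, 1], 1, 0, 0, 1, by simp [det_fin_three],
        by simp, fun x ↦ ?_, fun x ↦ ?_⟩ <;>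
      · simp [tform_apply, dotProduct, Fin.sum_univ_three]
        field_simp
        try ring
    -- The shear has determinant 1, so the block determinant bc - d² is unchanged.
    · contrapose! hf
      linear_combination b * hf.1 - (d - b * (d' / b')) * hf.2
  by_cases hb' : b' = 0
  · by_cases hc' : c' = 0
    · have hd' : d' ≠ 0 := fun h ↦ hh ⟨hb', hc', h⟩
      refine PencilEq.reaches ?_ (reaches_yz ha b c)
      refine ⟨1, 1, 2 * d, 0, 2 * d', by simp, by simp [hd'], fun x ↦ ?_, fun x ↦ ?_⟩
      · simp [tform_apply]
      · simp [tform_apply, hb', hc']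
    · exact (pencilEq_swap_one_two ..).reaches (aux (by rwa [mul_comm]) hc')
  · exact aux hf hb'

/-! ### Singular point of the degenerate member at a base point -/

theorem reaches_isotropic_normal {c b' c' d' : ℝ} (hc : c ≠ 0)
    (hh : ¬(b' = 0 ∧ c' = 0 ∧ d' = 0)) :
    Reaches (tform 0 0 c 0 0 1) (tform 0 b' c' d' 0 0) := by
  by_cases hc' : c' = 0
  · subst hc'
    by_cases hd' : d' = 0
    · subst hd'
      have hb' : b' ≠ 0 := by simpa using hh
      refine ⟨.V, !![0, 0, -c / 2; 1, 0, 0; 0, 1, 0], -c, 0, 0, b', by simp [det_fin_three, hc],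
        by simp [hc, hb'], fun x ↦ ?_, fun x ↦ ?_⟩ <;>
      · simp [tform_apply, dotProduct, Fin.sum_univ_three, Orbit.rep, mono,
        -mul_eq_mul_left_iff]
        ring
    -- The new coordinates are y and b'y + 2d'z, whose product is the second form; the new z absorbs
    -- the rest of 2xy + cz².
    · refine ⟨.IV, !![-(c / (4 * d' ^ 2)) * b' ^ 2 / 2, c / (4 * d' ^ 2) * b',
        -(c / (4 * d' ^ 2)) / 2; 1, 0, 0; -b' / (2 * d'), 1 / (2 * d'), 0], -(c / (4 * d' ^ 2)), 0,
        0, 1, ?_, by simp [hc, hd'], fun x ↦ ?_, fun x ↦ ?_⟩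
      · simp [det_fin_three, hc, hd']
      · simp [tform_apply, dotProduct, Fin.sum_univ_three, Orbit.rep, mono,
        -mul_eq_mul_left_iff]
        field_simp
        ring
      · simp [tform_apply, dotProduct, Fin.sum_univ_three, Orbit.rep, mono,
        -mul_eq_mul_left_iff]
        field_simp
        ring
  -- Completing the square in z makes the second form diagonal. Subtracting c/c' times it from the
  -- first removes z² and leaves a multiple of y, whose cofactor becomes the third coordinate up to
  -- a scalar.
  · refine PencilEq.reaches ?_ (reaches_yz hc (c * b' / c' - c * d' ^ 2 / c' ^ 2) 0)
    refine ⟨!![c * d' / c', c / (2 * c') * (b' - 2 * d' ^ 2 / c'), -c / (2 * c'); 0, 1, 0;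
      1, -d' / c', 0], 1, -c / c', c' / c, 0, ?_, ?_, fun x ↦ ?_, fun x ↦ ?_⟩
    · simp [det_fin_three, hc, hc']
    · field_simp
      simp
    · simp [tform_apply, dotProduct, Fin.sum_univ_three]
      field_simp
      ring
    · simp [tform_apply, dotProduct, Fin.sum_univ_three]
      field_simp
      ring

theorem reaches_isotropic {b c d e k b' c' d' : ℝ}
    (hf : k ^ 2 * c - 2 * k * d * e + e ^ 2 * b ≠ 0) (hh : ¬(b' = 0 ∧ c' = 0 ∧ d' = 0)) :
    Reaches (tform 0 b c d e k) (tform 0 b' c' d' 0 0) := by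
  have aux {b c d e k b' c' d' : ℝ} (hk : k ≠ 0)
      (hf : k ^ 2 * c - 2 * k * d * e + e ^ 2 * b ≠ 0) (hh : ¬(b' = 0 ∧ c' = 0 ∧ d' = 0)) :
      Reaches (tform 0 b c d e k) (tform 0 b' c' d' 0 0) := by
    refine PencilEq.reaches ?_ (reaches_isotropic_normal
      (c := b * e ^ 2 / k ^ 2 + c - 2 * d * e / k) (b' := b' / k ^ 2)
      (c' := b' * e ^ 2 / k ^ 2 + c' - 2 * d' * e / k) (d' := d' / k - b' * e / k ^ 2) ?_ ?_)
    -- The new y is ky + ez, the coefficient of 2x in the first form; a shear in x then removes its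
    -- y² and yz terms.
    · refine ⟨!![1, -b / (2 * k ^ 2), -(d / k - b * e / k ^ 2); 0, 1 / k, -e / k; 0, 0, 1],
        1, 0, 0, 1, by simp [det_fin_three, hk], by simp, fun x ↦ ?_, fun x ↦ ?_⟩ <;>
      · simp [tform_apply, dotProduct, Fin.sum_univ_three]
        field_simp
        ring
    · contrapose! hf
      field_simp at hf
      linear_combination hf
    · contrapose! hh
      obtain ⟨h₁, h₂, h₃⟩ := hh
      have hb' : b' = 0 := by simpa [hk] using h₁
      have hd' : d' = 0 := by simpa [hk, hb'] using h₃
      exact ⟨hb', by simpa [hb', hd'] using h₂, hd'⟩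
  by_cases hk : k = 0
  · by_cases he : e = 0
    · simp [hk, he] at hf
    · refine (pencilEq_swap_one_two ..).reaches (aux he ?_ fun h ↦ hh ⟨h.2.1, h.1, h.2.2⟩)
      contrapose! hf
      linear_combination hf
  · exact aux hk hf hh

theorem reaches_of_kernel {a b c d e k b' c' d' : ℝ}
    (hf : !![a, k, e; k, b, d; e, d, c].det ≠ 0) (hh : ¬(b' = 0 ∧ c' = 0 ∧ d' = 0)) :
    Reaches (tform a b c d e k) (tform 0 b' c' d' 0 0) := by
  simp [det_fin_three] at hf
  by_cases ha : a = 0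
  · subst ha
    refine reaches_isotropic ?_ hh
    contrapose! hf
    linear_combination -hf
  · refine PencilEq.reaches ?_ (reaches_block (b := b - k ^ 2 / a) (c := c - e ^ 2 / a)
      (d := d - k * e / a) ha ?_ hh)
    · refine ⟨!![1, -k / a, -e / a; 0, 1, 0; 0, 0, 1], 1, 0, 0, 1, by simp [det_fin_three],
        by simp, fun x ↦ ?_, fun x ↦ ?_⟩ <;>
      · simp [tform_apply, dotProduct, Fin.sum_univ_three]
        try field_simp
        try ring
    · contrapose! hf
      field_simp at hf
      apply mul_left_cancel₀ ha
      linear_combination hf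

/-! ### A singular member and its kernel -/

theorem exists_cubic_root {p : ℝ} (hp : p ≠ 0) (q r s : ℝ) :
    ∃ t : ℝ, p * t ^ 3 + q * t ^ 2 + r * t + s = 0 := by
  have key {q r s : ℝ} : ∃ t : ℝ, t ^ 3 + q * t ^ 2 + r * t + s = 0 := by
    -- At ±N the leading term dominates the others, so the cubic changes sign on [-N, N].
    set N := 1 + |q| + |r| + |s| with hN
    have hN1 : 1 ≤ N := by
      rw [hN]
      linarith [abs_nonneg q, abs_nonneg r, abs_nonneg s]
    have hq := abs_le.1 (le_refl |q|)
    have hr := abs_le.1 (le_refl |r|)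
    have hs := abs_le.1 (le_refl |s|)
    have b₁ : |q| * N ^ 2 + |r| * N + |s| ≤ N ^ 3 := by
      have e₁ : |r| * N ≤ |r| * N ^ 2 := by gcongr; nlinarith
      have e₂ : |s| ≤ |s| * N ^ 2 := by
        have : 1 ≤ N ^ 2 := by nlinarith
        nlinarith [abs_nonneg s]
      have e₃ : N ^ 3 = (1 + |q| + |r| + |s|) * N ^ 2 := by
        rw [← hN]
        ring
      nlinarith [sq_nonneg N]
    have b₂ : |q| * N ^ 2 ≥ q * N ^ 2 ∧ -(|q| * N ^ 2) ≤ q * N ^ 2 := by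
      constructor <;> nlinarith [sq_nonneg N]
    have b₃ : |r| * N ≥ r * N ∧ -(|r| * N) ≤ r * N := by
      constructor <;> nlinarith
    have hcont : ContinuousOn (fun t : ℝ ↦ t ^ 3 + q * t ^ 2 + r * t + s) (Set.Icc (-N) N) := by
      fun_prop
    obtain ⟨t, -, ht⟩ := intermediate_value_Icc (by linarith : -N ≤ N) hcont
      (show (0 : ℝ) ∈ _ from ⟨by linarith [b₂.1, b₃.2], by linarith [b₂.2, b₃.2]⟩)
    exact ⟨t, ht⟩
  obtain ⟨t, ht⟩ := key (q := q / p) (r := r / p) (s := s / p)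
  refine ⟨t, ?_⟩
  field_simp at ht
  linear_combination ht

theorem exists_matrix_first_column {v : Fin 3 → ℝ} (hv : v ≠ 0) :
    ∃ P : Matrix (Fin 3) (Fin 3) ℝ, P.det ≠ 0 ∧ P *ᵥ Pi.single 0 1 = v := by
  obtain ⟨i, hi⟩ := Function.ne_iff.1 hv
  fin_cases i
  · refine ⟨!![v 0, 0, 0; v 1, 1, 0; v 2, 0, 1], by simpa [det_fin_three] using hi, ?_⟩
    ext i; fin_cases i <;> simp
  · refine ⟨!![v 0, 1, 0; v 1, 0, 0; v 2, 0, 1], by simpa [det_fin_three] using hi, ?_⟩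
    ext i; fin_cases i <;> simp
  · refine ⟨!![v 0, 1, 0; v 1, 0, 1; v 2, 0, 0], by simpa [det_fin_three] using hi, ?_⟩
    ext i; fin_cases i <;> simp

/-- Every pair of independent forms, the first one non-degenerate, is equivalent to one of Levy's
representatives. -/
theorem reaches_of_isNondegenerate {f g : TernaryForm} (hf : IsNondegenerate f)
    (hfg : LinearIndependent ℝ ![f, g]) : Reaches f g := by
  have hf' := isNondegenerate_iff.1 hf
  obtain ⟨t, ht⟩ := exists_cubic_root hf'
    (mixedDet (QuadraticForm.toMatrix' f) (QuadraticForm.toMatrix' g))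
    (mixedDet (QuadraticForm.toMatrix' g) (QuadraticForm.toMatrix' f))
    (QuadraticForm.toMatrix' g).det
  set h : TernaryForm := t • f + g with hh
  have hH : QuadraticForm.toMatrix' h =
      t • QuadraticForm.toMatrix' f + (1 : ℝ) • QuadraticForm.toMatrix' g := by
    simp [hh, QuadraticForm.toMatrix']
  have hdet : (QuadraticForm.toMatrix' h).det = 0 := by
    rw [hH, det_smul_add_smul, ← ht]
    ring
  obtain ⟨v, hv, hv'⟩ := exists_mulVec_eq_zero_iff.2 hdet
  obtain ⟨P, hP, hPv⟩ := exists_matrix_first_column hv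
  have step : PencilEq f g (f.comp (toLin' P)) (h.comp (toLin' P)) := by
    refine ⟨P, 1, 0, -t, 1, hP, by simp, fun x ↦ by simp, fun x ↦ ?_⟩
    simp [hh]
  refine step.reaches ?_
  set F := f.comp (toLin' P) with hF
  set G := h.comp (toLin' P) with hG
  have hGm : QuadraticForm.toMatrix' G *ᵥ Pi.single 0 1 = 0 := by
    rw [hG, QuadraticForm.toMatrix'_comp, LinearMap.toMatrix'_toLin', ← mulVec_mulVec,
      ← mulVec_mulVec, hPv, hv', mulVec_zero]
  have hG0 (i : Fin 3) : QuadraticForm.toMatrix' G i 0 = 0 := by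
    simpa using congrFun hGm i
  have hFdet : (QuadraticForm.toMatrix' F).det ≠ 0 := by
    rw [hF, QuadraticForm.toMatrix'_comp, LinearMap.toMatrix'_toLin', det_mul, det_mul,
      det_transpose]
    exact mul_ne_zero (mul_ne_zero hP hf') hP
  rw [eq_tform F, toMatrix'_tform] at hFdet
  rw [eq_tform F, eq_tform G, hG0, toMatrix'_apply_comm G 0 2, toMatrix'_apply_comm G 0 1, hG0, hG0]
  refine reaches_of_kernel hFdet fun hzero ↦ ?_
  have hGzero : G = 0 := by
    rw [eq_tform G, hG0, toMatrix'_apply_comm G 0 2, toMatrix'_apply_comm G 0 1, hG0, hG0,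
      hzero.1, hzero.2.1, hzero.2.2]
    ext x
    simp [tform_apply]
  have hhzero : h = 0 := by
    ext x
    have := congr($hGzero (P⁻¹ *ᵥ x))
    simpa [hG, mul_nonsing_inv P hP.isUnit] using this
  have := (LinearIndependent.pair_iff.1 hfg t 1 (by simpa [hh] using hhzero)).2
  exact one_ne_zero this

/-! ### Invariants of the representatives -/

theorem rep_I : Orbit.I.rep = (tform 1 (-1) 0 0 0 0, tform 1 0 (-1) 0 0 0) := by
  ext x <;> simp [Orbit.rep, mono, tform_apply] <;> ring

theorem rep_Ia : Orbit.Ia.rep = (tform 1 1 1 0 0 0, tform 0 0 0 0 (1 / 2) 0) := by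
  ext x <;> simp [Orbit.rep, mono, tform_apply] <;> ring

theorem rep_Ib : Orbit.Ib.rep = (tform 1 1 (-1) 0 0 0, tform 0 0 0 0 (1 / 2) 0) := by
  ext x <;> simp [Orbit.rep, mono, tform_apply] <;> ring

theorem rep_II : Orbit.II.rep =
    (tform 0 0 0 (1 / 2) 0 0, tform 0 0 0 0 (-1 / 2) (1 / 2)) := by
  ext x <;> simp [Orbit.rep, mono, tform_apply] <;> ring

theorem rep_IIa : Orbit.IIa.rep = (tform 0 1 1 0 0 0, tform 0 0 0 0 (1 / 2) 0) := by
  ext x <;> simp [Orbit.rep, mono, tform_apply] <;> ring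

theorem rep_III : Orbit.III.rep = (tform 0 0 0 0 (1 / 2) 0, tform 0 1 0 0 0 0) := by
  ext x <;> simp [Orbit.rep, mono, tform_apply] <;> ring

theorem rep_IIIa : Orbit.IIIa.rep = (tform 1 1 0 0 0 0, tform 0 0 1 0 0 0) := by
  ext x <;> simp [Orbit.rep, mono, tform_apply] <;> ring

theorem rep_IV : Orbit.IV.rep = (tform 0 (-1) 0 0 (1 / 2) 0, tform 0 0 0 0 0 (1 / 2)) := by
  ext x <;> simp [Orbit.rep, mono, tform_apply] <;> ring

theorem rep_V : Orbit.V.rep = (tform 0 (-1) 0 0 (1 / 2) 0, tform 1 0 0 0 0 0) := by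
  ext x <;> simp [Orbit.rep, mono, tform_apply] <;> ring

theorem charDisc_rep_pos {o : Orbit} (ho : o = .I ∨ o = .Ia) :
    0 < charDisc o.rep.1 o.rep.2 := by
  rcases ho with rfl | rfl <;>
    simp [rep_I, rep_Ia, charDisc, toMatrix'_tform, cubicDisc, mixedDet, det_fin_three,
      adjugate_fin_three, trace,
      Fin.sum_univ_three] <;> norm_num

theorem charDisc_rep_neg : charDisc Orbit.Ib.rep.1 Orbit.Ib.rep.2 < 0 := by
  simp [rep_Ib, charDisc, toMatrix'_tform, cubicDisc, mixedDet, det_fin_three,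
    adjugate_fin_three, trace,
      Fin.sum_univ_three]
  norm_num

theorem charDisc_rep_eq_zero {o : Orbit} (hI : o ≠ .I) (hIa : o ≠ .Ia) (hIb : o ≠ .Ib) :
    charDisc o.rep.1 o.rep.2 = 0 := by
  cases o <;> first | contradiction | skip
  all_goals
    simp [rep_II, rep_IIa, rep_III, rep_IIIa, rep_IV, rep_V, charDisc, toMatrix'_tform, cubicDisc,
      mixedDet, det_fin_three, adjugate_fin_three, trace,
      Fin.sum_univ_three]

theorem hessian_rep_ne_zero {o : Orbit} (hIV : o ≠ .IV) (hV : o ≠ .V) :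
    hessian o.rep.1 o.rep.2 ≠ 0 := by
  intro h
  have key (t u : ℝ) := eval_hessian o.rep.1 o.rep.2 ![t, u]
  rw [h] at key
  have h₁ := key 1 0
  have h₂ := key 0 1
  clear h key
  cases o <;> first | contradiction | skip
  all_goals
    simp [rep_I, rep_Ia, rep_Ib, rep_II, rep_IIa, rep_III, rep_IIIa, toMatrix'_tform, cubicHessian,
      mixedDet, det_fin_three, adjugate_fin_three, trace,
      Fin.sum_univ_three] at h₁ h₂
  all_goals norm_num at h₁ h₂

/-- In both cases Φ is a multiple of t³. -/
theorem hessian_rep_eq_zero {o : Orbit} (ho : o = .IV ∨ o = .V) :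
    hessian o.rep.1 o.rep.2 = 0 := by
  refine MvPolynomial.funext fun x ↦ ?_
  rw [eval_hessian]
  rcases ho with rfl | rfl <;>
    simp [rep_IV, rep_V, toMatrix'_tform, cubicHessian, mixedDet, det_fin_three,
      adjugate_fin_three, trace,
      Fin.sum_univ_three]

theorem covariantG_rep_ne_zero {o : Orbit} (ho : o = .II ∨ o = .IIa ∨ o = .IV) :
    covariantG o.rep.1 o.rep.2 ≠ 0 := by
  intro h
  have key (x y z : ℝ) := eval_autopolarTriangle (QuadraticForm.isSymm_toMatrix' o.rep.1)
    (QuadraticForm.isSymm_toMatrix' o.rep.2) ![x, y, z]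
  rw [← covariantG, h] at key
  have h₁ := key 1 2 3
  clear h key
  rcases ho with rfl | rfl | rfl <;>
    simp [rep_II, rep_IIa, rep_IV, toMatrix'_tform, tangential, omega, adjugate_fin_three,
      crossMatrix, trace, Fin.sum_univ_three] at h₁ <;> norm_num at h₁

/-- The second generator is a square of a coordinate, so its tangential form, the last row of M, is
zero. -/
theorem covariantG_rep_eq_zero {o : Orbit} (ho : o = .III ∨ o = .IIIa ∨ o = .V) :
    covariantG o.rep.1 o.rep.2 = 0 := by
  refine MvPolynomial.funext fun x ↦ ?_
  rw [covariantG, eval_autopolarTriangle (QuadraticForm.isSymm_toMatrix' o.rep.1)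
    (QuadraticForm.isSymm_toMatrix' o.rep.2)]
  rcases ho with rfl | rfl | rfl <;>
    simp [rep_III, rep_IIIa, rep_V, toMatrix'_tform, tangential, omega, adjugate_fin_three,
      crossMatrix, trace, Fin.sum_univ_three]

theorem PencilEq.hessian_eq_zero_iff {f g f' g' : TernaryForm} (h : PencilEq f g f' g') :
    hessian f g = 0 ↔ hessian f' g' = 0 :=
  ⟨h.symm.hessian_eq_zero, h.hessian_eq_zero⟩

theorem PencilEq.covariantG_eq_zero_iff {f g f' g' : TernaryForm} (h : PencilEq f g f' g') :
    covariantG f g = 0 ↔ covariantG f' g' = 0 :=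
  ⟨h.symm.covariantG_eq_zero, h.covariantG_eq_zero⟩

end ConicPencil

/-! ### Assembling the classification -/

theorem mainTheorem6 (f g : ConicPencil.TernaryForm)
    (hf : ConicPencil.IsNondegenerate f) (hg : ConicPencil.IsNondegenerate g)
    (hfg : LinearIndependent ℝ ![f, g]) :
    (ConicPencil.tactInvariant f g < 0 ↔
      ConicPencil.GeneratesIn f g .I ∨ ConicPencil.GeneratesIn f g .Ia) ∧
    (0 < ConicPencil.tactInvariant f g ↔ ConicPencil.GeneratesIn f g .Ib) ∧
    (ConicPencil.tactInvariant f g = 0 ↔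
      ConicPencil.GeneratesIn f g .II ∨ ConicPencil.GeneratesIn f g .IIa ∨
      ConicPencil.GeneratesIn f g .III ∨ ConicPencil.GeneratesIn f g .IIIa ∨
      ConicPencil.GeneratesIn f g .IV ∨ ConicPencil.GeneratesIn f g .V) ∧
    (ConicPencil.tactInvariant f g = 0 →
      ((ConicPencil.hessian f g ≠ 0 ∧ ConicPencil.covariantG f g ≠ 0 ↔
          ConicPencil.GeneratesIn f g .II ∨ ConicPencil.GeneratesIn f g .IIa) ∧
        (ConicPencil.hessian f g ≠ 0 ∧ ConicPencil.covariantG f g = 0 ↔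
          ConicPencil.GeneratesIn f g .III ∨ ConicPencil.GeneratesIn f g .IIIa) ∧
        (ConicPencil.hessian f g = 0 ∧ ConicPencil.covariantG f g ≠ 0 ↔
          ConicPencil.GeneratesIn f g .IV) ∧
        (ConicPencil.hessian f g = 0 ∧ ConicPencil.covariantG f g = 0 ↔
          ConicPencil.GeneratesIn f g .V))) := by
  have hG := ConicPencil.generatesIn_iff hfg
  have inv (o : ConicPencil.Orbit) (ho : ConicPencil.GeneratesIn f g o) :=
    (hG o).1 ho
  obtain ⟨o, ho⟩ := ConicPencil.reaches_of_isNondegenerate hf hfg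
  have hT := ConicPencil.tactInvariant_eq hf g
  have hneg {o : ConicPencil.Orbit} (h : ConicPencil.GeneratesIn f g o)
      (hr : o = .I ∨ o = .Ia) : ConicPencil.tactInvariant f g < 0 := by
    obtain ⟨k, hk, e⟩ := (inv o h).charDisc_eq
    have := mul_pos hk (ConicPencil.charDisc_rep_pos hr)
    rw [hT, e]
    linarith
  have hpos (h : ConicPencil.GeneratesIn f g .Ib) : 0 < ConicPencil.tactInvariant f g := by
    obtain ⟨k, hk, e⟩ := (inv _ h).charDisc_eq
    have := mul_neg_of_pos_of_neg hk ConicPencil.charDisc_rep_neg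
    rw [hT, e]
    linarith
  have hzero {o : ConicPencil.Orbit} (h : ConicPencil.GeneratesIn f g o) (hI : o ≠ .I)
      (hIa : o ≠ .Ia) (hIb : o ≠ .Ib) : ConicPencil.tactInvariant f g = 0 := by
    obtain ⟨k, hk, e⟩ := (inv o h).charDisc_eq
    rw [hT, e, ConicPencil.charDisc_rep_eq_zero hI hIa hIb]
    simp
  have hH {o : ConicPencil.Orbit} (h : ConicPencil.GeneratesIn f g o) :
      ConicPencil.hessian f g = 0 ↔ o = .IV ∨ o = .V := by
    rw [(inv o h).hessian_eq_zero_iff]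
    refine ⟨fun h0 ↦ ?_, ConicPencil.hessian_rep_eq_zero⟩
    by_contra! hne
    exact ConicPencil.hessian_rep_ne_zero hne.1 hne.2 h0
  have hC {o : ConicPencil.Orbit} (h : ConicPencil.GeneratesIn f g o) (hI : o ≠ .I)
      (hIa : o ≠ .Ia) (hIb : o ≠ .Ib) :
      ConicPencil.covariantG f g = 0 ↔ o = .III ∨ o = .IIIa ∨ o = .V := by
    rw [(inv o h).covariantG_eq_zero_iff]
    refine ⟨fun h0 ↦ ?_, ConicPencil.covariantG_rep_eq_zero⟩
    by_contra! hne
    refine ConicPencil.covariantG_rep_ne_zero ?_ h0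
    cases o <;> simp_all
  rw [← hG] at ho
  -- The orbit o is one that the pencil reaches. Each forward implication excludes every o whose
  -- invariants contradict the hypothesis; each converse reads the invariants off the given orbit.
  refine ⟨⟨fun h ↦ ?_, fun h ↦ ?_⟩, ⟨fun h ↦ ?_, hpos⟩, ⟨fun h ↦ ?_, fun h ↦ ?_⟩, fun h ↦ ?_⟩
  · cases o
    case I => exact Or.inl ho
    case Ia => exact Or.inr ho
    case Ib => exact absurd h (hpos ho).not_gt
    all_goals exact absurd (hzero ho (by simp) (by simp) (by simp)) h.ne
  · rcases h with h | h <;> exact hneg h (by simp)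
  · cases o
    case I | Ia => exact absurd h (hneg ho (by simp)).not_gt
    case Ib => exact ho
    all_goals exact absurd (hzero ho (by simp) (by simp) (by simp)) h.ne'
  · cases o
    case I | Ia => exact absurd h (hneg ho (by simp)).ne
    case Ib => exact absurd h (hpos ho).ne'
    all_goals simp [ho]
  · rcases h with h | h | h | h | h | h <;> exact hzero h (by simp) (by simp) (by simp)
  · have hI {o : ConicPencil.Orbit} (ho : ConicPencil.GeneratesIn f g o) :
        o ≠ .I ∧ o ≠ .Ia ∧ o ≠ .Ib := by
      refine ⟨?_, ?_, ?_⟩ <;> rintro rfl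
      · exact (hneg ho (by simp)).ne h
      · exact (hneg ho (by simp)).ne h
      · exact (hpos ho).ne' h
    have hC' {o : ConicPencil.Orbit} (ho : ConicPencil.GeneratesIn f g o) :=
      hC ho (hI ho).1 (hI ho).2.1 (hI ho).2.2
    have hI' := hI ho
    refine ⟨⟨fun hc ↦ ?_, fun hc ↦ ?_⟩, ⟨fun hc ↦ ?_, fun hc ↦ ?_⟩, ⟨fun hc ↦ ?_, fun hc ↦ ?_⟩,
      ⟨fun hc ↦ ?_, fun hc ↦ ?_⟩⟩
    · rw [Ne, Ne, hH ho, hC' ho] at hc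
      cases o <;> simp_all
    · rcases hc with hc | hc <;> simp [hH hc, hC' hc]
    · rw [Ne, hH ho, hC' ho] at hc
      cases o <;> simp_all
    · rcases hc with hc | hc <;> simp [hH hc, hC' hc]
    · rw [Ne, hH ho, hC' ho] at hc
      cases o <;> simp_all
    · simp [hH hc, hC' hc]
    · rw [hH ho, hC' ho] at hc
      cases o <;> simp_all
    · simp [hH hc, hC' hc]
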